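/- Let $p\ge 1$ and let $\mathbf k=(0,0,1)\in\mathbb R^3$. Let $G$ be the group, under pointwise multiplication, of smooth maps $\psi:\mathbb R^p\to SO(3)$ that equal the identity outside some compact set (this is the meaning of $\psi(\infty)=\mathrm{Id}$). Let $\mathcal N_p$ be the set of smooth maps $n:\mathbb R^p\to\mathbb R^3$ with $|n(x)|=1$ for all $x$ and $n=-\mathbf k$ outside some compact set. For $n\in\mathcal N_2$ put $$\deg n=\frac1{4\pi}\int_{\mathbb R^2} n\cdot\Bigl(\frac{\partial n}{\partial x}\times\frac{\partial n}{\partial y}\Bigr)\,dx\,dy .$$ Let $\mathfrak g^*$ be the space of smooth maps $\mathbb R^p\to\mathbb R^3$, on which $G$ acts (coadjoint action) by $(A\cdot\mu)(x)=A(x)\mu(x)$. Let $T^*G=G\times\mathfrak g^*$ (right trivialization), with the action $A\cdot(\psi,\mu)=(\psi A^{-1},\mu)$ of $G$ and the momentum map $J^G(\psi,\mu)=-\psi^{-1}\mu$. For $\mu\in\mathfrak g^*$ let $G_\mu\subseteq G$ be the isotropy group of $\mu$; it acts on $(J^G)^{-1}(\mu)$. For the constant momentum $\mu=\mathbf k$,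 the assignment $(\psi,\nu)\mapsto-\psi\mathbf k$ induces a map $\Phi_p:(J^G)^{-1}(\mathbf k)/G_{\mathbf k}\to\mathcal N_p$. Then: 1. If $p\ne2$, every $n\in\mathcal N_p$ lifts to some $\psi\in G$ with $n=-\psi\mathbf k$, and $\Phi_p$ is a bijection onto $\mathcal N_p$. 2. If $p=2$, a field $n\in\mathcal N_2$ has a lift $\psi\in G$ with $n=-\psi\mathbf k$ if and only if $\deg n=0$, and $\Phi_2$ is injective with image exactly $\{n\in\mathcal N_2:\deg n=0\}$. -/

import Mathlib

open scoped Matrix ContDiff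

noncomputable section

namespace LandauLifshitz

/-- The space `ℝ^p`. -/
abbrev Space (p : ℕ) : Type := EuclideanSpace ℝ (Fin p)

/-- The rotation group `SO(3)`, acting on `Fin 3 → ℝ` by `*ᵥ`. -/
abbrev SO3 : Type := Matrix.specialOrthogonalGroup (Fin 3) ℝ

/-- The action of a rotation on a vector. -/
def rot (A : SO3) (v : Fin 3 → ℝ) : Fin 3 → ℝ := (A : Matrix (Fin 3) (Fin 3) ℝ) *ᵥ v

/-- The third unit vector `𝐤`. -/
def kVec : Fin 3 → ℝ := ![0, 0, 1]

/-- Smoothness of a map into `SO(3)`, as a map into the `3 × 3` matrices. -/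
def SmoothRot {p : ℕ} (ψ : Space p → SO3) : Prop :=
  ∀ i j, ContDiff ℝ ∞ fun x => (ψ x : Matrix (Fin 3) (Fin 3) ℝ) i j

lemma rot_one (v : Fin 3 → ℝ) : rot 1 v = v := by simp [rot]

lemma rot_mul (A B : SO3) (v : Fin 3 → ℝ) : rot (A * B) v = rot A (rot B v) := by
  simp [rot]

lemma rot_neg (A : SO3) (v : Fin 3 → ℝ) : rot A (-v) = -rot A v := by
  simp [rot, Matrix.mulVec_neg]

lemma rot_dotProduct_rot (A : SO3) (v : Fin 3 → ℝ) : rot A v ⬝ᵥ rot A v = v ⬝ᵥ v := by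
  have h : (A : Matrix (Fin 3) (Fin 3) ℝ)ᵀ * (A : Matrix (Fin 3) (Fin 3) ℝ) = 1 := by
    have := (Matrix.mem_orthogonalGroup_iff' (Fin 3) ℝ).1
      (Matrix.mem_specialOrthogonalGroup_iff.1 A.2).1
    simpa [Matrix.star_eq_conjTranspose] using this
  unfold rot
  rw [Matrix.dotProduct_mulVec, Matrix.vecMul_mulVec, h, Matrix.vecMul_one]

lemma coe_inv_apply (A : SO3) (i j : Fin 3) :
    ((A⁻¹ : SO3) : Matrix (Fin 3) (Fin 3) ℝ) i j = (A : Matrix (Fin 3) (Fin 3) ℝ) j i := by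
  rfl

lemma SmoothRot.rot {p : ℕ} {ψ : Space p → SO3} (hψ : SmoothRot ψ)
    {v : Space p → Fin 3 → ℝ} (hv : ContDiff ℝ ∞ v) :
    ContDiff ℝ ∞ fun x => rot (ψ x) (v x) := by
  rw [contDiff_pi] at hv ⊢
  intro i
  change ContDiff ℝ ∞ fun x => ∑ j, (ψ x : Matrix (Fin 3) (Fin 3) ℝ) i j * v x j
  exact ContDiff.sum fun j _ => (hψ i j).mul (hv j)

lemma SmoothRot.inv {p : ℕ} {ψ : Space p → SO3} (hψ : SmoothRot ψ) :
    SmoothRot fun x => (ψ x)⁻¹ := fun i j => by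
  simpa only [coe_inv_apply] using hψ j i

/-- The group `G` of smooth maps `A : ℝ^p → SO(3)` with `A(∞) = Id`, that is, equal to the
identity outside some compact set, with pointwise multiplication. -/
def gaugeGroup (p : ℕ) : Subgroup (Space p → SO3) where
  carrier := {ψ | SmoothRot ψ ∧ ∃ K : Set (Space p), IsCompact K ∧ ∀ x ∉ K, ψ x = 1}
  one_mem' := by
    refine ⟨fun i j => ?_, ∅, isCompact_empty, fun x _ => rfl⟩
    exact contDiff_const
  mul_mem' := by
    rintro ψ φ ⟨hψ, K, hK, hKψ⟩ ⟨hφ, L, hL, hLφ⟩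
    refine ⟨fun i j => ?_, K ∪ L, hK.union hL, fun x hx => ?_⟩
    · change ContDiff ℝ ∞ fun x => ∑ l, (ψ x : Matrix (Fin 3) (Fin 3) ℝ) i l *
        (φ x : Matrix (Fin 3) (Fin 3) ℝ) l j
      exact ContDiff.sum fun l _ => (hψ i l).mul (hφ l j)
    · rw [Set.mem_union, not_or] at hx
      simp [hKψ x hx.1, hLφ x hx.2]
  inv_mem' := by
    rintro ψ ⟨hψ, K, hK, hKψ⟩
    exact ⟨hψ.inv, K, hK, fun x hx => by simp [hKψ x hx]⟩

/-- The dual `𝔤*`: smooth `ℝ³`-valued maps on `ℝ^p`, with no condition at infinity. It pairs with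
the compactly supported maps `ξ ∈ 𝔤` by `⟨μ, ξ⟩ = ∫ μ(x) · ξ(x)`. -/
def dualAlgebra (p : ℕ) : Submodule ℝ (Space p → Fin 3 → ℝ) where
  carrier := {μ | ContDiff ℝ ∞ μ}
  add_mem' := by
    intro μ ν (hμ : ContDiff ℝ ∞ μ) (hν : ContDiff ℝ ∞ ν)
    exact hμ.add hν
  zero_mem' := by
    change ContDiff ℝ ∞ fun _ : Space p => (0 : Fin 3 → ℝ)
    exact contDiff_const
  smul_mem' := by
    intro c μ (hμ : ContDiff ℝ ∞ μ)
    exact hμ.const_smul c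

/-- The coadjoint action of `G` on `𝔤*`: `(CoAd_A μ)(x) = A(x) μ(x)`. -/
instance coadjointAction (p : ℕ) : MulAction (gaugeGroup p) (dualAlgebra p) where
  smul A μ := ⟨fun x => rot (A.1 x) (μ.1 x), A.2.1.rot μ.2⟩
  one_smul _ := Subtype.ext (funext fun _ => rot_one _)
  mul_smul _ _ _ := Subtype.ext (funext fun _ => rot_mul _ _ _)

lemma coadjoint_apply {p : ℕ} (A : gaugeGroup p) (μ : dualAlgebra p) (x : Space p) :
    (A • μ).1 x = rot (A.1 x) (μ.1 x) := rfl

/-- The cotangent bundle `T*G`, represented by pairs `(ψ, μ) ∈ G × 𝔤*` using right translation. -/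
@[ext]
structure CotangentBundle (p : ℕ) where
  /-- The base point. -/
  base : gaugeGroup p
  /-- The covector, right translated to the identity. -/
  covector : dualAlgebra p

/-- The action of `G` on `T*G` by right translation: `A · (ψ, μ) = (ψ A⁻¹, μ)`. -/
instance rightTranslation (p : ℕ) : MulAction (gaugeGroup p) (CotangentBundle p) where
  smul A z := ⟨z.base * A⁻¹, z.covector⟩
  one_smul z := by
    refine CotangentBundle.ext ?_ rfl
    change z.base * 1⁻¹ = z.base
    simp
  mul_smul A B z := by
    refine CotangentBundle.ext ?_ rfl
    change z.base * (A * B)⁻¹ = z.base * B⁻¹ * A⁻¹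
    simp [mul_assoc]

lemma base_smul {p : ℕ} (A : gaugeGroup p) (z : CotangentBundle p) :
    (A • z).base = z.base * A⁻¹ := rfl

/-- The momentum map of right translation, `J^G(ψ, μ)(x) = -ψ(x)⁻¹ μ(x)`. -/
def momentumMap {p : ℕ} (z : CotangentBundle p) : dualAlgebra p :=
  -(z.base⁻¹ • z.covector)

lemma momentumMap_smul {p : ℕ} (A : gaugeGroup p) (z : CotangentBundle p) :
    momentumMap (A • z) = A • momentumMap z := by
  apply Subtype.ext
  funext x
  change -rot (z.base.1 x * (A.1 x)⁻¹)⁻¹ (z.covector.1 x)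
    = rot (A.1 x) (-rot (z.base.1 x)⁻¹ (z.covector.1 x))
  rw [rot_neg, mul_inv_rev, inv_inv, rot_mul]

/-- The level set `(J^G)⁻¹(μ)`. -/
def levelSet {p : ℕ} (μ : dualAlgebra p) : Set (CotangentBundle p) :=
  {z | momentumMap z = μ}

/-- The isotropy group `G_μ` of `μ` under the coadjoint action. -/
abbrev isotropy {p : ℕ} (μ : dualAlgebra p) : Subgroup (gaugeGroup p) :=
  MulAction.stabilizer (gaugeGroup p) μ

/-- The action of `G_μ` on `(J^G)⁻¹(μ)` by right translation. -/
instance levelSetAction {p : ℕ} (μ : dualAlgebra p) : MulAction (isotropy μ) (levelSet μ) where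
  smul A z := ⟨A.1 • z.1, by
    have hz : momentumMap z.1 = μ := z.2
    have hA : A.1 • μ = μ := A.2
    change momentumMap (A.1 • z.1) = μ
    rw [momentumMap_smul, hz, hA]⟩
  one_smul z := Subtype.ext (one_smul (gaugeGroup p) z.1)
  mul_smul A B z := Subtype.ext (mul_smul A.1 B.1 z.1)

/-- The reduced space `(J^G)⁻¹(μ) / G_μ`. -/
def ReducedSpace {p : ℕ} (μ : dualAlgebra p) : Type :=
  MulAction.orbitRel.Quotient (isotropy μ) (levelSet μ)

/-- The constant momentum `μ(x) = 𝐤`. -/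
def constK (p : ℕ) : dualAlgebra p := ⟨fun _ => kVec, by
  change ContDiff ℝ ∞ fun _ : Space p => kVec
  exact contDiff_const⟩

/-- The smooth fields `n` of unit vectors on `ℝ^p` that are equal to `-𝐤` outside some compact
set. The Euclidean unit length condition is written `n(x) · n(x) = 1`. -/
def unitFields (p : ℕ) : Set (Space p → Fin 3 → ℝ) :=
  {n | ContDiff ℝ ∞ n ∧ (∀ x, n x ⬝ᵥ n x = 1) ∧
    ∃ K : Set (Space p), IsCompact K ∧ ∀ x ∉ K, n x = -kVec}

/-- The map `ψ ↦ -ψ𝐤` from `G` to the unit vector fields. -/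
def fieldOf {p : ℕ} (ψ : gaugeGroup p) : unitFields p :=
  ⟨fun x => -rot (ψ.1 x) kVec, (ψ.2.1.rot contDiff_const).neg,
    fun x => by
      rw [neg_dotProduct_neg, rot_dotProduct_rot]
      simp [kVec, dotProduct, Fin.sum_univ_three],
    by
      obtain ⟨K, hK, h⟩ := ψ.2.2
      exact ⟨K, hK, fun x hx => by simp only [h x hx, rot_one]⟩⟩

/-- The map `(J^G)⁻¹(𝐤) / G_𝐤 → {n}` induced by `(ψ, ν) ↦ -ψ𝐤`. -/
def reducedToField (p : ℕ) : ReducedSpace (constK p) → unitFields p :=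
  Quotient.lift (fun z : levelSet (constK p) => fieldOf z.1.base) (by
    rintro z w ⟨A, rfl⟩
    apply Subtype.ext
    funext x
    change -rot (w.1.base.1 x * (A.1.1 x)⁻¹) kVec = -rot (w.1.base.1 x) kVec
    have hA : rot (A.1.1 x) kVec = kVec := congrFun (congrArg Subtype.val A.2) x
    have hA' : rot (A.1.1 x)⁻¹ kVec = kVec := by
      conv_lhs => rw [← hA]
      rw [← rot_mul, inv_mul_cancel, rot_one]
    rw [rot_mul, hA'])

/-- The partial derivative `∂n/∂xᵢ` on the plane. -/
def partialDeriv (n : Space 2 → Fin 3 → ℝ) (i : Fin 2) (x : Space 2) : Fin 3 → ℝ :=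
  fderiv ℝ n x (EuclideanSpace.single i 1)

/-- The degree of a field on the plane, `deg n = (1/4π) ∫ n · (∂n/∂x × ∂n/∂y)`. The integrand is
continuous with compact support for `n` in `unitFields 2`. -/
def degree (n : Space 2 → Fin 3 → ℝ) : ℝ :=
  1 / (4 * Real.pi) *
    ∫ x, n x ⬝ᵥ (crossProduct (partialDeriv n 0 x) (partialDeriv n 1 x))

end LandauLifshitz

end

noncomputable section

namespace LandauLifshitz

/-! On the level set the covector is `-ψ𝐤` (`covector_eq`), and two `ψ` with the same field differ
by an element of the isotropy group. Hence the induced map is injective and its image consists of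
the fields that lift. What remains is a lifting problem for `A ↦ -A𝐤` from `SO(3)` to the sphere, a
circle bundle; the obstruction lives in `π_{p-1}(S¹)`, which is nonzero only for `p = 2`.

Sweeping a box outside which `n = -𝐤` along the first coordinate joins `-𝐤` to `n` by a chain of
fields whose consecutive members are never antipodal. Each step is covered by a product of two half
turns (`exists_rotation_lift`). The resulting lift is the identity off the box, except where `x 0`
is large: there it fixes `𝐤`, so it is a rotation about `𝐤`, with a phase depending only on the
other `p - 1` coordinates and equal to 1 at infinity. If the phase is `exp(iθ)` with `θ` zero
outside a box, a rotation about `𝐤` undoes it without changing the field (`SweptLift.exists_gauge`).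
For `p = 1` the phase is constant. For `p ≥ 3` connectedness forces `θ = 0` at infinity. For `p = 2`
a constant `w` may survive where `x 1` is large.

In the plane, the degree integrand is minus the curl of the connection form `e₁ · de₂` of the lift,
and Stokes gives `deg n = w / 4π` (`WindingLift.degree_eq`). Degree zero thus means `w = 0`, which
gives a lift in `G`; conversely a lift in `G` is the case `w = 0` of the same formula. -/

/-! ### Rotations: half turns and rotations about the third axis. -/

lemma coe_orthogonal (A : SO3) :
    (A : Matrix (Fin 3) (Fin 3) ℝ) * (A : Matrix (Fin 3) (Fin 3) ℝ)ᵀ = 1 := by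
  have := (Matrix.mem_orthogonalGroup_iff (Fin 3) ℝ).1
    (Matrix.mem_specialOrthogonalGroup_iff.1 A.2).1
  simpa [Matrix.star_eq_conjTranspose] using this

lemma coe_orthogonal' (A : SO3) :
    (A : Matrix (Fin 3) (Fin 3) ℝ)ᵀ * (A : Matrix (Fin 3) (Fin 3) ℝ) = 1 :=
  mul_eq_one_comm.1 (coe_orthogonal A)

lemma coe_det (A : SO3) : (A : Matrix (Fin 3) (Fin 3) ℝ).det = 1 :=
  (Matrix.mem_specialOrthogonalGroup_iff.1 A.2).2

lemma mem_SO3 {M : Matrix (Fin 3) (Fin 3) ℝ} (h : M * Mᵀ = 1) (hd : M.det = 1) :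
    M ∈ Matrix.specialOrthogonalGroup (Fin 3) ℝ := by
  rw [Matrix.mem_specialOrthogonalGroup_iff, Matrix.mem_orthogonalGroup_iff]
  refine ⟨?_, hd⟩
  simpa [Matrix.star_eq_conjTranspose] using h

lemma rot_apply (A : SO3) (v : Fin 3 → ℝ) (i : Fin 3) :
    rot A v i = ∑ j, (A : Matrix (Fin 3) (Fin 3) ℝ) i j * v j := rfl

lemma rot_kVec_apply (A : SO3) (i : Fin 3) :
    rot A kVec i = (A : Matrix (Fin 3) (Fin 3) ℝ) i 2 := by
  simp [rot_apply, Fin.sum_univ_three, kVec]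

lemma smoothRot_mul {p : ℕ} {ψ φ : Space p → SO3} (hψ : SmoothRot ψ) (hφ : SmoothRot φ) :
    SmoothRot fun x => ψ x * φ x := fun i j => by
  change ContDiff ℝ ∞ fun x => ∑ l, (ψ x : Matrix (Fin 3) (Fin 3) ℝ) i l *
    (φ x : Matrix (Fin 3) (Fin 3) ℝ) l j
  exact ContDiff.sum fun l _ => (hψ i l).mul (hφ l j)

/-- The matrix of the rotation by the angle `π` about the axis spanned by `v`. -/
def halfTurnMatrix (v : Fin 3 → ℝ) : Matrix (Fin 3) (Fin 3) ℝ :=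
  Matrix.of fun i j => 2 * v i * v j / (v ⬝ᵥ v) - if i = j then 1 else 0

lemma halfTurnMatrix_mem {v : Fin 3 → ℝ} (hv : v ⬝ᵥ v ≠ 0) :
    halfTurnMatrix v ∈ Matrix.specialOrthogonalGroup (Fin 3) ℝ := by
  have hq : (v ⬝ᵥ v)⁻¹ * (v 0 * v 0 + v 1 * v 1 + v 2 * v 2) = 1 := by
    have h : v ⬝ᵥ v = v 0 * v 0 + v 1 * v 1 + v 2 * v 2 := by
      simp [dotProduct, Fin.sum_univ_three]
    rw [← h, inv_mul_cancel₀ hv]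
  apply mem_SO3
  · ext i j
    have key : (halfTurnMatrix v * (halfTurnMatrix v)ᵀ) i j =
        (1 : Matrix (Fin 3) (Fin 3) ℝ) i j + 4 * (v ⬝ᵥ v)⁻¹ * v i * v j *
          ((v ⬝ᵥ v)⁻¹ * (v 0 * v 0 + v 1 * v 1 + v 2 * v 2) - 1) := by
      fin_cases i <;> fin_cases j <;>
        simp [Matrix.mul_apply, halfTurnMatrix, Fin.sum_univ_three, div_eq_mul_inv] <;> ring
    rw [key, hq]
    ring
  · simp [Matrix.det_fin_three, halfTurnMatrix, div_eq_mul_inv]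
    linear_combination 2 * hq

open Classical in
/-- The rotation by the angle `π` about the axis spanned by `v`. -/
def halfTurn (v : Fin 3 → ℝ) : SO3 :=
  if hv : v ⬝ᵥ v ≠ 0 then ⟨halfTurnMatrix v, halfTurnMatrix_mem hv⟩ else 1

lemma coe_halfTurn {v : Fin 3 → ℝ} (hv : v ⬝ᵥ v ≠ 0) :
    (halfTurn v : Matrix (Fin 3) (Fin 3) ℝ) = halfTurnMatrix v := by
  rw [halfTurn, dif_pos hv]

lemma rot_halfTurn {v : Fin 3 → ℝ} (hv : v ⬝ᵥ v ≠ 0) (u : Fin 3 → ℝ) :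
    rot (halfTurn v) u = (2 * (v ⬝ᵥ u) / (v ⬝ᵥ v)) • v - u := by
  ext i
  have h : v ⬝ᵥ u = v 0 * u 0 + v 1 * u 1 + v 2 * u 2 := by
    simp [dotProduct, Fin.sum_univ_three]
  rw [rot_apply, coe_halfTurn hv, h]
  fin_cases i <;> simp [halfTurnMatrix, Fin.sum_univ_three] <;> field_simp <;> ring

/-- The half turn about `a + b` alone already carries the unit vector `a` to `b`. Composing it with
the half turn about `a`, which fixes `a`, makes the product trivial when `a = b`, so lifts stay
equal to 1 where a chain is constant. -/
lemma halfTurn_add_self_mul {v : Fin 3 → ℝ} (hv : v ⬝ᵥ v ≠ 0) :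
    halfTurn (v + v) * halfTurn v = 1 := by
  have h1 : halfTurn (v + v) = halfTurn v := by
    have h2 : (v + v) ⬝ᵥ (v + v) = 4 * (v ⬝ᵥ v) := by
      simp only [add_dotProduct, dotProduct_add]; ring
    apply Subtype.ext
    rw [coe_halfTurn hv, coe_halfTurn (by rw [h2]; simpa using hv)]
    ext i j
    simp only [halfTurnMatrix, Matrix.of_apply, h2, Pi.add_apply]
    field_simp
    ring
  have h3 : (halfTurn v)⁻¹ = halfTurn v := by
    apply Subtype.ext
    ext i j
    rw [coe_inv_apply, coe_halfTurn hv]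
    simp only [halfTurnMatrix, Matrix.of_apply, eq_comm (a := i)]
    ring
  rw [h1]
  nth_rw 1 [← h3]
  exact inv_mul_cancel _

/-- The composition of two half turns carries the unit vector `a` to the unit vector `b`. -/
lemma rot_halfTurn_mul {a b : Fin 3 → ℝ} (ha : a ⬝ᵥ a = 1) (hb : b ⬝ᵥ b = 1)
    (hab : (a + b) ⬝ᵥ (a + b) ≠ 0) : rot (halfTurn (a + b) * halfTurn a) a = b := by
  have h1 : rot (halfTurn a) a = a := by
    rw [rot_halfTurn (by simp [ha]), ha]; ext i; simp; ring
  have h2 : (a + b) ⬝ᵥ (a + b) = 2 * ((a + b) ⬝ᵥ a) := by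
    simp only [add_dotProduct, dotProduct_add, ha, hb, dotProduct_comm b a]; ring
  rw [rot_mul, h1, rot_halfTurn hab, ← h2, div_self hab]
  simp

lemma smoothRot_halfTurn {p : ℕ} {v : Space p → Fin 3 → ℝ} (hv : ContDiff ℝ ∞ v)
    (h0 : ∀ x, v x ⬝ᵥ v x ≠ 0) : SmoothRot fun x => halfTurn (v x) := fun i j => by
  have hv' := contDiff_pi.1 hv
  simp only [coe_halfTurn (h0 _), halfTurnMatrix, Matrix.of_apply]
  refine ContDiff.sub (ContDiff.div ((contDiff_const.mul (hv' i)).mul (hv' j)) ?_ h0)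
    contDiff_const
  exact ContDiff.sum fun l _ => (hv' l).mul (hv' l)

/-- The rotation by the angle `t` about the third axis. -/
def rotZ (t : ℝ) : SO3 :=
  ⟨!![Real.cos t, -Real.sin t, 0; Real.sin t, Real.cos t, 0; 0, 0, 1], by
    have h := Real.sin_sq_add_cos_sq t
    apply mem_SO3
    · ext i j
      fin_cases i <;> fin_cases j <;> simp [Matrix.mul_apply, Fin.sum_univ_three] <;>
        first | linear_combination h | ring
    · simp [Matrix.det_fin_three]
      linear_combination h⟩

lemma coe_rotZ (t : ℝ) : (rotZ t : Matrix (Fin 3) (Fin 3) ℝ) =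
    !![Real.cos t, -Real.sin t, 0; Real.sin t, Real.cos t, 0; 0, 0, 1] := rfl

lemma rot_rotZ_kVec (t : ℝ) : rot (rotZ t) kVec = kVec := by
  ext i
  rw [rot_kVec_apply, coe_rotZ]
  fin_cases i <;> simp [kVec]

lemma rotZ_zero : rotZ 0 = 1 := by
  apply Subtype.ext
  rw [coe_rotZ]
  ext i j
  fin_cases i <;> fin_cases j <;> simp

lemma rotZ_mul_rotZ_neg (t : ℝ) : rotZ t * rotZ (-t) = 1 := by
  have h := Real.sin_sq_add_cos_sq t
  apply Subtype.ext
  change (rotZ t : Matrix (Fin 3) (Fin 3) ℝ) * (rotZ (-t) : Matrix (Fin 3) (Fin 3) ℝ) = 1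
  rw [coe_rotZ, coe_rotZ]
  ext i j
  fin_cases i <;> fin_cases j <;> simp [Matrix.mul_apply, Fin.sum_univ_three] <;>
    first | linear_combination h | ring

lemma smoothRot_rotZ {p : ℕ} {θ : Space p → ℝ} (hθ : ContDiff ℝ ∞ θ) :
    SmoothRot fun x => rotZ (θ x) := fun i j => by
  have hc : ContDiff ℝ ∞ fun x => Real.cos (θ x) := Real.contDiff_cos.comp hθ
  have hs : ContDiff ℝ ∞ fun x => Real.sin (θ x) := Real.contDiff_sin.comp hθ
  simp only [coe_rotZ]
  fin_cases i <;> fin_cases j <;> simp <;>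
    first | exact hc | exact hs | exact hs.neg | exact contDiff_const

/-- The first column of a rotation, seen as a complex number. -/
def colComplex (A : SO3) : ℂ :=
  ⟨(A : Matrix (Fin 3) (Fin 3) ℝ) 0 0, (A : Matrix (Fin 3) (Fin 3) ℝ) 1 0⟩

lemma colComplex_one : colComplex 1 = 1 := by
  apply Complex.ext <;> simp [colComplex]

lemma rotation_fixing_kVec {A : SO3} (hA : rot A kVec = kVec) :
    ‖colComplex A‖ = 1 ∧
      ∀ t : ℝ, Complex.exp (t * Complex.I) = colComplex A → A = rotZ t := by
  have h02 : (A : Matrix (Fin 3) (Fin 3) ℝ) 0 2 = 0 := by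
    rw [← rot_kVec_apply, hA]; simp [kVec]
  have h12 : (A : Matrix (Fin 3) (Fin 3) ℝ) 1 2 = 0 := by
    rw [← rot_kVec_apply, hA]; simp [kVec]
  have h22 : (A : Matrix (Fin 3) (Fin 3) ℝ) 2 2 = 1 := by
    rw [← rot_kVec_apply, hA]; simp [kVec]
  have r22 := congrFun (congrFun (coe_orthogonal A) 2) 2
  have c00 := congrFun (congrFun (coe_orthogonal' A) 0) 0
  have c11 := congrFun (congrFun (coe_orthogonal' A) 1) 1
  have hd := coe_det A
  simp [Matrix.mul_apply, Fin.sum_univ_three, h22] at r22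
  have h20 : (A : Matrix (Fin 3) (Fin 3) ℝ) 2 0 = 0 := by nlinarith
  have h21 : (A : Matrix (Fin 3) (Fin 3) ℝ) 2 1 = 0 := by nlinarith
  simp [Matrix.mul_apply, Fin.sum_univ_three, h20, h21] at c00 c11
  simp [Matrix.det_fin_three, h20, h21, h22, h02, h12] at hd
  -- The unit columns and the determinant give `(A₁₁ - A₀₀)² + (A₀₁ + A₁₀)² = 1 + 1 - 2 = 0`.
  have e1 : (A : Matrix (Fin 3) (Fin 3) ℝ) 1 1 = (A : Matrix (Fin 3) (Fin 3) ℝ) 0 0 := by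
    nlinarith [sq_nonneg ((A : Matrix (Fin 3) (Fin 3) ℝ) 1 1 - (A : Matrix (Fin 3) (Fin 3) ℝ) 0 0),
      sq_nonneg ((A : Matrix (Fin 3) (Fin 3) ℝ) 0 1 + (A : Matrix (Fin 3) (Fin 3) ℝ) 1 0)]
  have e2 : (A : Matrix (Fin 3) (Fin 3) ℝ) 0 1 = -(A : Matrix (Fin 3) (Fin 3) ℝ) 1 0 := by
    nlinarith [sq_nonneg ((A : Matrix (Fin 3) (Fin 3) ℝ) 1 1 - (A : Matrix (Fin 3) (Fin 3) ℝ) 0 0),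
      sq_nonneg ((A : Matrix (Fin 3) (Fin 3) ℝ) 0 1 + (A : Matrix (Fin 3) (Fin 3) ℝ) 1 0)]
  constructor
  · have : Complex.normSq (colComplex A) = 1 := by
      rw [Complex.normSq_apply]; exact c00
    rw [Complex.normSq_eq_norm_sq] at this
    nlinarith [norm_nonneg (colComplex A)]
  · intro t ht
    have hre := congrArg Complex.re ht
    have him := congrArg Complex.im ht
    rw [Complex.exp_ofReal_mul_I_re] at hre
    rw [Complex.exp_ofReal_mul_I_im] at him
    have hre' : (A : Matrix (Fin 3) (Fin 3) ℝ) 0 0 = Real.cos t := hre.symm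
    have him' : (A : Matrix (Fin 3) (Fin 3) ℝ) 1 0 = Real.sin t := him.symm
    apply Subtype.ext
    rw [coe_rotZ]
    ext i j
    fin_cases i <;> fin_cases j <;> simp [*]

/-! ### Sweeping a box along a coordinate. -/

/-- The point `x` with its `j`-th coordinate replaced by `c`. -/
def setCoord {p : ℕ} (j : Fin p) (c : ℝ) (x : Space p) : Space p :=
  x + (c - x j) • EuclideanSpace.single j 1

lemma setCoord_apply {p : ℕ} (j : Fin p) (c : ℝ) (x : Space p) (i : Fin p) :
    setCoord j c x i = if i = j then c else x i := by
  by_cases h : i = j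
  · subst h; simp [setCoord]
  · simp [setCoord, h]

lemma dist_setCoord {p : ℕ} (j : Fin p) (c d : ℝ) (x : Space p) :
    dist (setCoord j c x) (setCoord j d x) = |c - d| := by
  rw [dist_eq_norm]
  have : setCoord j c x - setCoord j d x = (c - d) • EuclideanSpace.single j (1 : ℝ) := by
    rw [setCoord, setCoord, add_sub_add_left_eq_sub, ← sub_smul]; congr 1; ring
  rw [this, norm_smul]
  simp

lemma contDiff_coord {p : ℕ} (j : Fin p) : ContDiff ℝ ∞ fun x : Space p => x j :=
  (EuclideanSpace.proj (𝕜 := ℝ) j).contDiff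

lemma contDiff_setCoord {p : ℕ} (j : Fin p) {c : Space p → ℝ} (hc : ContDiff ℝ ∞ c) :
    ContDiff ℝ ∞ fun x => setCoord j (c x) x :=
  contDiff_id.add ((hc.sub (contDiff_coord j)).smul contDiff_const)

/-- `F` depends only on the coordinates in `S`, and is equal to `c` as soon as one of these has
absolute value at least `R`. -/
structure BoxSupported {p : ℕ} {E : Type*} (S : Finset (Fin p)) (R : ℝ) (c : E)
    (F : Space p → E) : Prop where
  eq_const : ∀ x, ∀ i ∈ S, R ≤ |x i| → F x = c
  congr : ∀ x y, (∀ i ∈ S, x i = y i) → F x = F y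

/-- The support need not be compact when `S` omits a coordinate. However, `F` is unchanged by
clamping all coordinates to `[-R, R]`, so it factors through a uniformly continuous retraction onto
a compact cube. -/
lemma BoxSupported.uniformContinuous {p : ℕ} {E : Type*} [PseudoMetricSpace E]
    {S : Finset (Fin p)} {R : ℝ} {c : E} {F : Space p → E} (hR : 0 ≤ R)
    (h : BoxSupported S R c F) (hF : Continuous F) : UniformContinuous F := by
  let cl : Space p → Space p := fun x => WithLp.toLp 2 fun i => max (-R) (min R (x i))
  have hcl : UniformContinuous cl := by
    refine (PiLp.uniformContinuous_toLp 2 _).comp (uniformContinuous_pi.2 fun i => ?_)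
    have h1 : LipschitzWith 1 fun t : ℝ => max (-R) (min R t) :=
      (LipschitzWith.id.const_min R).const_max (-R)
    exact h1.uniformContinuous.comp (EuclideanSpace.proj (𝕜 := ℝ) i).uniformContinuous
  have hFcl : ∀ x, F x = F (cl x) := by
    intro x
    by_cases hx : ∃ i ∈ S, R ≤ |x i|
    · obtain ⟨i, hi, hxi⟩ := hx
      rw [h.eq_const x i hi hxi, h.eq_const (cl x) i hi]
      change R ≤ |max (-R) (min R (x i))|
      rcases le_abs.1 hxi with h1 | h1
      · rw [min_eq_left h1, max_eq_right (by linarith)]; exact le_abs_self R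
      · rw [min_eq_right (by linarith), max_eq_left (by linarith), abs_neg]; exact le_abs_self R
    · push Not at hx
      refine h.congr _ _ fun i hi => ?_
      have := abs_lt.1 (hx i hi)
      change x i = max (-R) (min R (x i))
      rw [min_eq_right this.2.le, max_eq_right this.1.le]
  have hK : IsCompact ((WithLp.toLp 2 : (Fin p → ℝ) → Space p) '' Set.Icc (fun _ => -R) fun _ => R) :=
    isCompact_Icc.image (PiLp.continuous_toLp 2 _)
  have hu := hK.uniformContinuousOn_of_continuous hF.continuousOn
  have h2 : UniformContinuous (F ∘ cl) := by
    rw [← uniformContinuousOn_univ] at hcl ⊢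
    refine hu.comp hcl fun x _ => ⟨_, ⟨fun i => le_max_left _ _, fun i => ?_⟩, rfl⟩
    exact max_le (by linarith) (min_le_left _ _)
  rwa [show F = F ∘ cl from funext hFcl]

/-- A smooth function equal to `t` for `t ≤ R` and to `R + 1` for `t ≥ R + 1`. -/
def cutoff (R t : ℝ) : ℝ :=
  t + Real.smoothTransition (t - R) * (R + 1 - t)

lemma contDiff_cutoff (R : ℝ) : ContDiff ℝ ∞ (cutoff R) :=
  contDiff_id.add ((Real.smoothTransition.contDiff.comp (contDiff_id.sub contDiff_const)).mul
    (contDiff_const.sub contDiff_id))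

lemma cutoff_of_le {R t : ℝ} (h : t ≤ R) : cutoff R t = t := by
  rw [cutoff, Real.smoothTransition.zero_of_nonpos (by linarith)]; ring

lemma cutoff_of_ge {R t : ℝ} (h : R + 1 ≤ t) : cutoff R t = R + 1 := by
  rw [cutoff, Real.smoothTransition.one_of_one_le (by linarith)]; ring

lemma cutoff_mem {R t : ℝ} (h : R ≤ t) : R ≤ cutoff R t ∧ cutoff R t ≤ R + 1 := by
  rcases le_total (R + 1) t with h1 | h1
  · rw [cutoff_of_ge h1]; constructor <;> linarith
  · have h2 := Real.smoothTransition.nonneg (t - R)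
    have h3 := Real.smoothTransition.le_one (t - R)
    constructor
    · rw [cutoff]; nlinarith
    · rw [cutoff]; nlinarith

/-- A function supported in a box is joined to a constant by finitely many small steps, sweeping
the box in the direction of the coordinate `j`. -/
lemma BoxSupported.exists_slices {p : ℕ} {E : Type*} [NormedAddCommGroup E] [NormedSpace ℝ E]
    {S : Finset (Fin p)} {R : ℝ} {c : E} {F : Space p → E} (hR : 0 ≤ R)
    (h : BoxSupported S R c F) (hF : ContDiff ℝ ∞ F) {j : Fin p} (hj : j ∈ S) :
    ∃ (N : ℕ) (f : ℕ → Space p → E), (∀ k, ContDiff ℝ ∞ (f k)) ∧ (∀ x, f 0 x = c) ∧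
      (∀ x, f N x = F x) ∧ (∀ k x, ∃ y, f k x = F y) ∧
      (∀ k x, dist (f (k + 1) x) (f k x) < 1) ∧
      (∀ k x, x j ≤ -R → f k x = c) ∧
      (∀ k x, ∀ i ∈ S, i ≠ j → R ≤ |x i| → f k x = c) ∧
      (∀ k x y, (∀ i ∈ S, i ≠ j → x i = y i) → R + 1 ≤ x j → R + 1 ≤ y j → f k x = f k y) := by
  obtain ⟨δ, hδ, hu⟩ := Metric.uniformContinuous_iff.1 (h.uniformContinuous hR hF.continuous) 1
    one_pos
  -- Consecutive slices move a point with `-R ≤ x j` by at most `(2R + 1) / N`, which must be below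
  -- `δ`.
  obtain ⟨N, hN⟩ := exists_nat_gt ((2 * R + 1) / δ)
  have hN0 : (0 : ℝ) < N := lt_of_le_of_lt (by positivity) hN
  let s : ℕ → ℝ := fun k => k / N
  have hs0 : ∀ k, 0 ≤ s k := fun k => by positivity
  have hss : ∀ k, s (k + 1) - s k = 1 / N := fun k => by
    simp only [s]; push_cast; ring
  -- The `j`-th coordinate runs from `-R` to `cutoff R (x j)`. The cutoff keeps its range bounded
  -- above and makes every slice independent of `x j` beyond `R + 1`.
  let G : ℕ → Space p → Space p := fun k x =>
    setCoord j (-R + s k * (cutoff R (x j) + R)) x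
  have hGj : ∀ k x, G k x j = -R + s k * (cutoff R (x j) + R) := fun k x => by
    simp [G, setCoord_apply]
  have hGi : ∀ k x i, i ≠ j → G k x i = x i := fun k x i hi => by
    simp [G, setCoord_apply, hi]
  have hlow : ∀ k x, x j ≤ -R → F (G k x) = c := fun k x hx => by
    refine h.eq_const _ j hj ?_
    rw [hGj, cutoff_of_le (by linarith), abs_of_nonpos]
    · nlinarith [hs0 k, mul_nonneg (hs0 k) (by linarith : 0 ≤ -(x j + R))]
    · nlinarith [hs0 k, mul_nonneg (hs0 k) (by linarith : 0 ≤ -(x j + R))]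
  refine ⟨N, fun k x => F (G k x), fun k => ?_, fun x => ?_, fun x => ?_,
    fun k x => ⟨_, rfl⟩, fun k x => ?_, hlow, fun k x i hi hij hx => ?_,
    fun k x y hxy hx hy => ?_⟩
  · exact hF.comp (contDiff_setCoord j (contDiff_const.add (contDiff_const.mul
      (((contDiff_cutoff R).comp (contDiff_coord j)).add contDiff_const))))
  · refine h.eq_const _ j hj ?_
    rw [hGj]; simp [s, le_abs_self]
  · have hsN : s N = 1 := div_self hN0.ne'
    have hGN : G N x j = cutoff R (x j) := by rw [hGj, hsN]; ring
    rcases le_total (x j) R with hx | hx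
    · refine h.congr _ _ fun i _ => ?_
      by_cases hij : i = j
      · rw [hij, hGN, cutoff_of_le hx]
      · exact hGi _ _ _ hij
    · change F (G N x) = F x
      rw [h.eq_const (G N x) j hj, h.eq_const x j hj (hx.trans (le_abs_self _))]
      rw [hGN]
      exact (cutoff_mem hx).1.trans (le_abs_self _)
  · change dist (F (G (k + 1) x)) (F (G k x)) < 1
    -- To the left of the box the displacement is unbounded, but both values are `c`.
    rcases le_total (x j) (-R) with hx | hx
    · rw [hlow _ _ hx, hlow _ _ hx]; simp
    · apply hu
      rw [dist_setCoord]
      have h1 : 0 ≤ cutoff R (x j) + R ∧ cutoff R (x j) + R ≤ 2 * R + 1 := by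
        rcases le_total (x j) R with hx' | hx'
        · rw [cutoff_of_le hx']; constructor <;> linarith
        · have := cutoff_mem hx'; constructor <;> linarith
      have h2 : -R + s (k + 1) * (cutoff R (x j) + R) - (-R + s k * (cutoff R (x j) + R))
          = 1 / N * (cutoff R (x j) + R) := by rw [← hss k]; ring
      rw [h2, abs_of_nonneg (mul_nonneg (by positivity) h1.1)]
      rw [div_lt_iff₀ hδ] at hN
      rw [one_div, inv_mul_lt_iff₀ hN0]
      linarith
  · refine h.eq_const _ i hi ?_
    rwa [hGi _ _ _ hij]
  · refine h.congr _ _ fun i hi => ?_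
    by_cases hij : i = j
    · rw [hij, hGj, hGj, cutoff_of_ge hx, cutoff_of_ge hy]
    · rw [hGi _ _ _ hij, hGi _ _ _ hij, hxy i hi hij]

/-! ### Lifting chains of small steps. -/

/-- The distance is the sup distance. If `b = -a`, it is twice the largest `|a i|`, so each `|a i| <
1/2` and `a` has squared length below `3/4`. -/
lemma add_dotProduct_self_ne_zero {a b : Fin 3 → ℝ} (ha : a ⬝ᵥ a = 1) (hab : dist b a < 1) :
    (a + b) ⬝ᵥ (a + b) ≠ 0 := by
  intro h0
  rw [dotProduct_self_eq_zero] at h0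
  have hb : b = -a := by rw [← sub_eq_zero, sub_neg_eq_add, add_comm]; exact h0
  have h1 : ∀ i, |a i| < 1 / 2 := fun i => by
    have h2 := (dist_le_pi_dist b a i).trans_lt hab
    rw [hb, Real.dist_eq, Pi.neg_apply, show -a i - a i = -(2 * a i) by ring, abs_neg, abs_mul,
      abs_two] at h2
    linarith
  have h2 : ∀ i, a i * a i < 1 / 4 := fun i => by
    have := h1 i
    rw [← abs_mul_abs_self]
    nlinarith [abs_nonneg (a i)]
  simp only [dotProduct, Fin.sum_univ_three] at ha
  linarith [h2 0, h2 1, h2 2]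

/-- Lifting of a chain of unit vector fields with small steps to rotations. -/
lemma exists_rotation_lift {p : ℕ} {f : ℕ → Space p → Fin 3 → ℝ}
    (hf : ∀ k, ContDiff ℝ ∞ (f k)) (h1 : ∀ k x, f k x ⬝ᵥ f k x = 1)
    (hd : ∀ k x, dist (f (k + 1) x) (f k x) < 1) (h0 : ∀ x, f 0 x = -kVec) (N : ℕ) :
    ∃ ψ : Space p → SO3, SmoothRot ψ ∧ (∀ x, f N x = -rot (ψ x) kVec) ∧
      (∀ x, (∀ k, f k x = -kVec) → ψ x = 1) ∧
      (∀ x y, (∀ k, f k x = f k y) → ψ x = ψ y) := by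
  induction N with
  | zero =>
    exact ⟨fun _ => 1, fun i j => contDiff_const, fun x => by rw [h0, rot_one], fun _ _ => rfl,
      fun _ _ _ => rfl⟩
  | succ N ih =>
    obtain ⟨ψ, hψ, hl, hc, he⟩ := ih
    have ha : ∀ x, f N x ⬝ᵥ f N x ≠ 0 := fun x => by rw [h1]; exact one_ne_zero
    have hs : ∀ x, (f N x + f (N + 1) x) ⬝ᵥ (f N x + f (N + 1) x) ≠ 0 := fun x =>
      add_dotProduct_self_ne_zero (h1 N x) (hd N x)
    -- The lift at `x` is built from the values `f k x` alone, whence the last clause; where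
    -- consecutive values agree the new factor is 1.
    refine ⟨fun x => halfTurn (f N x + f (N + 1) x) * halfTurn (f N x) * ψ x,
      smoothRot_mul (smoothRot_mul (smoothRot_halfTurn ((hf N).add (hf (N + 1))) hs)
        (smoothRot_halfTurn (hf N) ha)) hψ, fun x => ?_, fun x hx => ?_, fun x y hxy => ?_⟩
    · rw [rot_mul, ← rot_neg, ← rot_neg, rot_neg (ψ x), ← hl,
        rot_halfTurn_mul (h1 N x) (h1 (N + 1) x) (hs x)]
    · have := halfTurn_add_self_mul (ha x)
      simp only [hc x hx, hx] at this ⊢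
      rw [this, one_mul]
    · simp only [he x y hxy, hxy]

/-- Lifting of a chain of functions with values in the unit circle to angles. -/
lemma exists_angle_lift {p : ℕ} {f : ℕ → Space p → ℂ}
    (hf : ∀ k, ContDiff ℝ ∞ (f k)) (h1 : ∀ k x, ‖f k x‖ = 1)
    (hd : ∀ k x, dist (f (k + 1) x) (f k x) < 1) (h0 : ∀ x, f 0 x = 1) (N : ℕ) :
    ∃ θ : Space p → ℝ, ContDiff ℝ ∞ θ ∧ (∀ x, Complex.exp (θ x * Complex.I) = f N x) ∧
      (∀ x, (∀ k, f k x = 1) → θ x = 0) ∧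
      (∀ x y, (∀ k, f k x = f k y) → θ x = θ y) := by
  induction N with
  | zero =>
    exact ⟨fun _ => 0, contDiff_const, fun x => by simp [h0], fun _ _ => rfl, fun _ _ _ => rfl⟩
  | succ N ih =>
    obtain ⟨θ, hθ, hl, hc, he⟩ := ih
    have hne : ∀ k x, f k x ≠ 0 := fun k x => by
      rw [← norm_ne_zero_iff, h1]; exact one_ne_zero
    have hn : ∀ x, ‖f (N + 1) x / f N x‖ = 1 := fun x => by rw [norm_div, h1, h1, div_one]
    -- The ratio lies within 1 of 1, hence off the branch cut of the logarithm.
    have hre : ∀ x, 0 < (f (N + 1) x / f N x).re := fun x => by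
      have h2 : ‖f (N + 1) x / f N x - 1‖ < 1 := by
        rw [div_sub_one (hne N x), norm_div, h1, div_one, ← dist_eq_norm]
        exact hd N x
      have h3 := (Complex.abs_re_le_norm _).trans_lt h2
      rw [Complex.sub_re, Complex.one_re] at h3
      linarith [(abs_lt.1 h3).1]
    refine ⟨fun x => θ x + (Complex.log (f (N + 1) x / f N x)).im, hθ.add ?_, fun x => ?_,
      fun x hx => ?_, fun x y hxy => ?_⟩
    · rw [contDiff_iff_contDiffAt]
      intro x
      have h2 : ContDiffAt ℝ ∞ (fun x => f (N + 1) x / f N x) x :=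
        (hf (N + 1)).contDiffAt.mul ((hf N).contDiffAt.inv (hne N x))
      have h3 : ContDiffAt ℝ ∞ Complex.log (f (N + 1) x / f N x) :=
        (Complex.contDiffAt_log (Or.inl (hre x))).restrict_scalars ℝ
      exact Complex.imCLM.contDiff.contDiffAt.comp x (h3.comp x h2)
    · push_cast
      rw [add_mul, Complex.exp_add, hl, Complex.log_im]
      have := Complex.norm_mul_exp_arg_mul_I (f (N + 1) x / f N x)
      rw [hn x, Complex.ofReal_one, one_mul] at this
      rw [this, mul_div_cancel₀ _ (hne N x)]
    · simp [hc x hx, hx]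
    · simp only [he x y hxy, hxy]

/-! ### Swept lifts, their limit phase and its removal. -/

lemma exists_boxSupported {p : ℕ} {E : Type*} {c : E} {F : Space p → E}
    (h : ∃ K : Set (Space p), IsCompact K ∧ ∀ x ∉ K, F x = c) :
    ∃ R, 0 ≤ R ∧ BoxSupported Finset.univ R c F := by
  obtain ⟨K, hK, h⟩ := h
  obtain ⟨R, hR⟩ := hK.isBounded.exists_norm_le
  refine ⟨max R 0 + 1, by positivity, fun x i _ hx => h x fun hxK => ?_, fun x y hxy => ?_⟩
  · have h1 := PiLp.norm_apply_le x i
    rw [Real.norm_eq_abs] at h1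
    linarith [hR x hxK, le_max_left R 0]
  · rw [show x = y from PiLp.ext fun i => hxy i (Finset.mem_univ i)]

lemma isCompact_box {p : ℕ} (C : ℝ) : IsCompact {x : Space p | ∀ i, |x i| ≤ C} := by
  have : {x : Space p | ∀ i, |x i| ≤ C} =
      (WithLp.toLp 2 : (Fin p → ℝ) → Space p) '' Set.Icc (fun _ => -C) fun _ => C := by
    ext x
    constructor
    · exact fun hx => ⟨x.ofLp, ⟨fun i => (abs_le.1 (hx i)).1, fun i => (abs_le.1 (hx i)).2⟩, rfl⟩
    · rintro ⟨y, ⟨h1, h2⟩, rfl⟩ i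
      exact abs_le.2 ⟨h1 i, h2 i⟩
  rw [this]
  exact isCompact_Icc.image (PiLp.continuous_toLp 2 _)

/-- A smooth lift which is trivial except in the direction of the first coordinate, and does not
depend on this coordinate where it is large. -/
structure SweptLift {q : ℕ} (R : ℝ) (n : Space (q + 1) → Fin 3 → ℝ) (ψ : Space (q + 1) → SO3) :
    Prop where
  smooth : SmoothRot ψ
  lift : ∀ x, n x = -rot (ψ x) kVec
  eq_one_of_le : ∀ x, x 0 ≤ -R → ψ x = 1
  eq_one : ∀ x, ∀ i ≠ 0, R ≤ |x i| → ψ x = 1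
  congr : ∀ x y, (∀ i ≠ 0, x i = y i) → R + 1 ≤ x 0 → R + 1 ≤ y 0 → ψ x = ψ y
  fix : ∀ x, R + 1 ≤ x 0 → rot (ψ x) kVec = kVec

lemma exists_sweptLift {q : ℕ} (n : unitFields (q + 1)) :
    ∃ R, 0 ≤ R ∧ ∃ ψ, SweptLift R n.1 ψ := by
  obtain ⟨n, hn, h1, hK⟩ := n
  obtain ⟨R, hR, hB⟩ := exists_boxSupported hK
  obtain ⟨N, f, hf, hf0, hfN, hfF, hfd, hlow, hside, hcongr⟩ :=
    hB.exists_slices hR hn (Finset.mem_univ 0)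
  obtain ⟨ψ, hψ, hl, hc, he⟩ := exists_rotation_lift hf
    (fun k x => by obtain ⟨y, hy⟩ := hfF k x; rw [hy, h1]) hfd hf0 N
  refine ⟨R, hR, ψ, hψ, fun x => by rw [← hl, hfN], fun x hx => hc x fun k => hlow k x hx,
    fun x i hi hx => hc x fun k => hside k x i (Finset.mem_univ _) hi hx,
    fun x y hxy hx hy => he x y fun k => hcongr k x y (fun i _ hi => hxy i hi) hx hy,
    fun x hx => ?_⟩
  -- Beyond the box the field is `-𝐤`, so the lift there fixes `𝐤`.
  have h2 := hB.eq_const x 0 (Finset.mem_univ _) ((by linarith : R ≤ x 0).trans (le_abs_self _))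
  rw [← hfN, hl] at h2
  exact neg_injective h2

/-- The value of a swept lift where the first coordinate is large, as a complex number. -/
def limitPhase {q : ℕ} (R : ℝ) (ψ : Space (q + 1) → SO3) (x : Space (q + 1)) : ℂ :=
  colComplex (ψ (setCoord 0 (R + 1) x))

lemma SweptLift.contDiff_limitPhase {q : ℕ} {R : ℝ} {n : Space (q + 1) → Fin 3 → ℝ}
    {ψ : Space (q + 1) → SO3} (h : SweptLift R n ψ) : ContDiff ℝ ∞ (limitPhase R ψ) := by
  have h1 : ∀ i j, ContDiff ℝ ∞ fun x =>
      (ψ (setCoord 0 (R + 1) x) : Matrix (Fin 3) (Fin 3) ℝ) i j := fun i j =>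
    (h.smooth i j).comp (contDiff_setCoord 0 contDiff_const)
  have h2 : limitPhase R ψ = fun x =>
      ((ψ (setCoord 0 (R + 1) x) : Matrix (Fin 3) (Fin 3) ℝ) 0 0 : ℂ) +
        ((ψ (setCoord 0 (R + 1) x) : Matrix (Fin 3) (Fin 3) ℝ) 1 0 : ℂ) * Complex.I := by
    funext x
    apply Complex.ext <;> simp [limitPhase, colComplex]
  rw [h2]
  exact (Complex.ofRealCLM.contDiff.comp (h1 0 0)).add
    ((Complex.ofRealCLM.contDiff.comp (h1 1 0)).mul contDiff_const)

lemma SweptLift.boxSupported_limitPhase {q : ℕ} {R : ℝ} {n : Space (q + 1) → Fin 3 → ℝ}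
    {ψ : Space (q + 1) → SO3} (h : SweptLift R n ψ) :
    BoxSupported (Finset.univ.erase 0) R 1 (limitPhase R ψ) := by
  constructor
  · intro x i hi hx
    have hi0 := Finset.ne_of_mem_erase hi
    rw [limitPhase, h.eq_one _ i hi0 (by rwa [setCoord_apply, if_neg hi0]), colComplex_one]
  · intro x y hxy
    have : setCoord 0 (R + 1) x = setCoord 0 (R + 1) y := PiLp.ext fun i => by
      rw [setCoord_apply, setCoord_apply]
      split_ifs with hi
      · rfl
      · exact hxy i (Finset.mem_erase.2 ⟨hi, Finset.mem_univ _⟩)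
    rw [limitPhase, limitPhase, this]

lemma SweptLift.norm_limitPhase {q : ℕ} {R : ℝ} {n : Space (q + 1) → Fin 3 → ℝ}
    {ψ : Space (q + 1) → SO3} (h : SweptLift R n ψ) (x : Space (q + 1)) :
    ‖limitPhase R ψ x‖ = 1 :=
  (rotation_fixing_kVec (h.fix _ (by simp [setCoord_apply]))).1

lemma SweptLift.eq_rotZ {q : ℕ} {R : ℝ} {n : Space (q + 1) → Fin 3 → ℝ}
    {ψ : Space (q + 1) → SO3} (h : SweptLift R n ψ) {x : Space (q + 1)} (hx : R + 1 ≤ x 0) {t : ℝ}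
    (ht : Complex.exp (t * Complex.I) = limitPhase R ψ x) : ψ x = rotZ t := by
  have h1 : ψ x = ψ (setCoord 0 (R + 1) x) := by
    refine h.congr _ _ (fun i hi => ?_) hx ?_
    · rw [setCoord_apply, if_neg hi]
    · rw [setCoord_apply, if_pos rfl]
  rw [h1]
  exact (rotation_fixing_kVec (h.fix _ (by simp [setCoord_apply]))).2 t ht

/-- The correction of a swept lift by a rotation about the third axis that is switched on along the
first coordinate. -/
def twist {q : ℕ} (ψ : Space (q + 1) → SO3) (θ : Space (q + 1) → ℝ) (x : Space (q + 1)) : SO3 :=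
  ψ x * rotZ (-(Real.smoothTransition (x 0) * θ x))

lemma contDiff_smoothTransition_coord {p : ℕ} (i : Fin p) :
    ContDiff ℝ ∞ fun x : Space p => Real.smoothTransition (x i) :=
  Real.smoothTransition.contDiff.comp (contDiff_coord i)

lemma SweptLift.smoothRot_twist {q : ℕ} {R : ℝ} {n : Space (q + 1) → Fin 3 → ℝ}
    {ψ : Space (q + 1) → SO3} (h : SweptLift R n ψ) {θ : Space (q + 1) → ℝ}
    (hθ : ContDiff ℝ ∞ θ) : SmoothRot (twist ψ θ) :=
  smoothRot_mul h.smooth (smoothRot_rotZ ((contDiff_smoothTransition_coord 0).mul hθ).neg)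

lemma SweptLift.lift_twist {q : ℕ} {R : ℝ} {n : Space (q + 1) → Fin 3 → ℝ}
    {ψ : Space (q + 1) → SO3} (h : SweptLift R n ψ) (θ : Space (q + 1) → ℝ) (x : Space (q + 1)) :
    n x = -rot (twist ψ θ x) kVec := by
  rw [twist, rot_mul, rot_rotZ_kVec, h.lift]

/-- For `x 0 ≥ R + 1 ≥ 1` the transition is complete and the twist cancels the phase; for `x 0 ≤ -(R
+ 1)` neither factor has started. -/
lemma SweptLift.twist_eq_one {q : ℕ} {R : ℝ} (hR : 0 ≤ R) {n : Space (q + 1) → Fin 3 → ℝ}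
    {ψ : Space (q + 1) → SO3} (h : SweptLift R n ψ) {θ : Space (q + 1) → ℝ}
    (hθ : ∀ x, Complex.exp (θ x * Complex.I) = limitPhase R ψ x) {x : Space (q + 1)}
    (hx : R + 1 ≤ |x 0|) : twist ψ θ x = 1 := by
  rcases le_abs.1 hx with hx | hx
  · rw [twist, h.eq_rotZ hx (hθ x), Real.smoothTransition.one_of_one_le (by linarith), one_mul,
      rotZ_mul_rotZ_neg]
  · rw [twist, h.eq_one_of_le x (by linarith), Real.smoothTransition.zero_of_nonpos (by linarith)]
    simp [rotZ_zero]

/-- Reduces lifting to a choice of angle. The equation for `θ` only puts it in `2πℤ` where the phase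
is 1; the twist needs exactly 0 there, since it scales `θ` by intermediate factors. -/
lemma SweptLift.exists_gauge {q : ℕ} {R : ℝ} (hR : 0 ≤ R) {n : Space (q + 1) → Fin 3 → ℝ}
    {ψ : Space (q + 1) → SO3} (h : SweptLift R n ψ) {θ : Space (q + 1) → ℝ}
    (hθs : ContDiff ℝ ∞ θ) (hθ : ∀ x, Complex.exp (θ x * Complex.I) = limitPhase R ψ x)
    (hθ0 : ∀ x, ∀ i ≠ 0, R + 1 ≤ |x i| → θ x = 0) :
    ∃ φ : gaugeGroup (q + 1), ∀ x, n x = -rot (φ.1 x) kVec := by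
  refine ⟨⟨twist ψ θ, h.smoothRot_twist hθs, {x | ∀ i, |x i| ≤ R + 1}, isCompact_box _,
    fun x hx => ?_⟩, h.lift_twist θ⟩
  simp only [Set.mem_ofPred_eq, not_forall, not_le] at hx
  obtain ⟨i, hi⟩ := hx
  by_cases hi0 : i = 0
  · subst hi0
    exact h.twist_eq_one hR hθ hi.le
  · rw [twist, h.eq_one x i hi0 (by linarith), hθ0 x i hi0 hi.le]
    simp [rotZ_zero]

/-- The angle of the limit phase, swept along the second coordinate. -/
lemma SweptLift.exists_angle {q : ℕ} {R : ℝ} (hR : 0 ≤ R) {n : Space (q + 2) → Fin 3 → ℝ}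
    {ψ : Space (q + 2) → SO3} (h : SweptLift R n ψ) :
    ∃ θ : Space (q + 2) → ℝ, ContDiff ℝ ∞ θ ∧
      (∀ x, Complex.exp (θ x * Complex.I) = limitPhase R ψ x) ∧
      (∀ x, x 1 ≤ -R → θ x = 0) ∧ (∀ x, ∀ i ≠ 0, i ≠ 1 → R ≤ |x i| → θ x = 0) ∧
      (∀ x y, (∀ i ≠ 0, i ≠ 1 → x i = y i) → R + 1 ≤ x 1 → R + 1 ≤ y 1 → θ x = θ y) := by
  obtain ⟨N, f, hf, hf0, hfN, hfF, hfd, hlow, hside, hcongr⟩ :=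
    h.boxSupported_limitPhase.exists_slices hR h.contDiff_limitPhase
      (Finset.mem_erase.2 ⟨one_ne_zero, Finset.mem_univ 1⟩)
  obtain ⟨θ, hθ, hl, hc, he⟩ := exists_angle_lift hf
    (fun k x => by obtain ⟨y, hy⟩ := hfF k x; rw [hy, h.norm_limitPhase]) hfd hf0 N
  refine ⟨θ, hθ, fun x => by rw [hl, hfN], fun x hx => hc x fun k => hlow k x hx,
    fun x i hi0 hi hx => hc x fun k =>
      hside k x i (Finset.mem_erase.2 ⟨hi0, Finset.mem_univ _⟩) hi hx,
    fun x y hxy hx hy => he x y fun k =>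
      hcongr k x y (fun i hi0 hi => hxy i (Finset.ne_of_mem_erase hi0) hi) hx hy⟩

/-! ### Lifts in dimension 1 and in dimensions at least 3. -/

/-- The values of `θ` lie in `2πℤ`; a nonzero one would force the value `π` or `-π` in between,
where the cosine is `-1`. -/
lemma eq_zero_of_exp_eq_one_of_isPreconnected {X : Type*} [TopologicalSpace X] {s : Set X}
    (hs : IsPreconnected s) {θ : X → ℝ} (hθ : ContinuousOn θ s)
    (h1 : ∀ x ∈ s, Complex.exp (θ x * Complex.I) = 1) {a : X} (ha : a ∈ s) (ha0 : θ a = 0)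
    {x : X} (hx : x ∈ s) : θ x = 0 := by
  by_contra hne
  have hcos : ∀ y ∈ s, Real.cos (θ y) = 1 := fun y hy => by
    rw [← Complex.exp_ofReal_mul_I_re, h1 y hy, Complex.one_re]
  have hpi := Real.pi_pos
  have hcx := hcos x hx
  rw [Real.cos_eq_one_iff] at hcx
  obtain ⟨m, hm⟩ := hcx
  have hm0 : m ≠ 0 := by rintro rfl; simp at hm; exact hne hm.symm
  rcases lt_or_gt_of_ne hm0 with hm' | hm'
  · have h2 : (m : ℝ) ≤ -1 := by exact_mod_cast Int.le_sub_one_of_lt hm'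
    obtain ⟨y, hy, hy'⟩ := hs.intermediate_value hx ha hθ
      (show -Real.pi ∈ Set.Icc (θ x) (θ a) by rw [ha0, ← hm]; constructor <;> nlinarith)
    have := hcos y hy
    rw [hy', Real.cos_neg, Real.cos_pi] at this
    norm_num at this
  · have h2 : (1 : ℝ) ≤ m := by exact_mod_cast hm'
    obtain ⟨y, hy, hy'⟩ := hs.intermediate_value ha hx hθ
      (show Real.pi ∈ Set.Icc (θ a) (θ x) by rw [ha0, ← hm]; constructor <;> nlinarith)
    have := hcos y hy
    rw [hy', Real.cos_pi] at this
    norm_num at this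

lemma exists_gauge_lift_one (n : unitFields 1) :
    ∃ ψ : gaugeGroup 1, ∀ x, n.1 x = -rot (ψ.1 x) kVec := by
  -- With no coordinate left, the limit phase is a constant and any argument of it will do.
  obtain ⟨R, hR, ψ, h⟩ := exists_sweptLift n
  refine h.exists_gauge hR (θ := fun _ => Complex.arg (limitPhase R ψ 0)) contDiff_const
    (fun x => ?_) fun x i hi => absurd (Fin.fin_one_eq_zero i) hi
  have h1 := Complex.norm_mul_exp_arg_mul_I (limitPhase R ψ 0)
  rw [h.norm_limitPhase, Complex.ofReal_one, one_mul] at h1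
  rw [h1]
  exact h.boxSupported_limitPhase.congr _ _ fun i hi =>
    absurd (Fin.fin_one_eq_zero i) (Finset.ne_of_mem_erase hi)

lemma exists_gauge_lift_add_three {q : ℕ} (n : unitFields (q + 3)) :
    ∃ ψ : gaugeGroup (q + 3), ∀ x, n.1 x = -rot (ψ.1 x) kVec := by
  obtain ⟨R, hR, ψ, h⟩ := exists_sweptLift n
  obtain ⟨θ, hθs, hθ, hlow, hside, -⟩ := h.exists_angle hR
  have h20 : (2 : Fin (q + 3)) ≠ 0 := by
    simp [Fin.ext_iff, Nat.mod_eq_of_lt (show 2 < q + 3 by omega)]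
  have h21 : (2 : Fin (q + 3)) ≠ 1 := by
    simp [Fin.ext_iff, Nat.mod_eq_of_lt (show 2 < q + 3 by omega)]
  refine h.exists_gauge hR hθs hθ fun x i hi hx => ?_
  by_cases hi1 : i = 1
  · subst hi1
    rcases le_abs.1 hx with hx | hx
    · have hconv : Convex ℝ {y : Space (q + 3) | R + 1 ≤ y 1} :=
        convex_halfSpace_ge (EuclideanSpace.proj (𝕜 := ℝ) (1 : Fin (q + 3))).isLinear (R + 1)
      -- The third coordinate can be moved to `R` without leaving the half space, and there the
      -- sweep gives `θ = 0`. In the plane this room is missing.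
      refine eq_zero_of_exp_eq_one_of_isPreconnected hconv.isPreconnected
        hθs.continuous.continuousOn (fun y hy => ?_) (a := setCoord 2 R x) ?_ ?_ hx
      · rw [hθ]
        exact h.boxSupported_limitPhase.eq_const y 1 (by simp)
          ((by linarith [show R + 1 ≤ y 1 from hy] : R ≤ y 1).trans (le_abs_self _))
      · change R + 1 ≤ setCoord 2 R x 1
        rwa [setCoord_apply, if_neg h21.symm]
      · exact hside _ 2 h20 h21 (by rw [setCoord_apply, if_pos rfl]; exact le_abs_self R)
    · exact hlow x (by linarith)
  · exact hside x i hi hi1 (by linarith)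

/-! ### The plane: lifts up to a winding. -/

/-- A lift of a field on the plane that is the identity at infinity, except for a winding by the
angle `w` on the upper half plane. -/
structure WindingLift (C w : ℝ) (n : Space 2 → Fin 3 → ℝ) (ψ : Space 2 → SO3) : Prop where
  smooth : SmoothRot ψ
  lift : ∀ x, n x = -rot (ψ x) kVec
  eq_one : ∀ x, C ≤ |x 0| → ψ x = 1
  eq_one_of_le : ∀ x, x 1 ≤ -C → ψ x = 1
  eq_rotZ : ∀ x, C ≤ x 1 → ψ x = rotZ (-(Real.smoothTransition (x 0) * w))

lemma exists_windingLift (n : unitFields 2) : ∃ C w, 1 ≤ C ∧ ∃ ψ, WindingLift C w n.1 ψ := by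
  obtain ⟨R, hR, ψ, h⟩ := exists_sweptLift n
  obtain ⟨θ, hθs, hθ, hlow, -, hcongr⟩ := h.exists_angle hR
  -- For `x 1 ≥ R + 1` the angle depends on neither coordinate, so its value at one such point is
  -- the winding.
  refine ⟨R + 1, θ (setCoord 1 (R + 1) 0), by linarith, twist ψ θ, h.smoothRot_twist hθs,
    h.lift_twist θ, fun x hx => h.twist_eq_one hR hθ hx, fun x hx => ?_, fun x hx => ?_⟩
  · rw [twist, h.eq_one x 1 one_ne_zero (le_abs.2 (Or.inr (by linarith))), hlow x (by linarith)]
    simp [rotZ_zero]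
  · rw [twist, h.eq_one x 1 one_ne_zero (le_abs.2 (Or.inl (by linarith))), one_mul,
      hcongr x (setCoord 1 (R + 1) 0) (fun i hi0 hi1 => ?_) hx (by simp [setCoord_apply])]
    fin_cases i
    · exact absurd rfl hi0
    · exact absurd rfl hi1

/-- A winding lift with trivial winding is the identity outside a compact set. -/
lemma WindingLift.exists_gauge {C : ℝ} {n : Space 2 → Fin 3 → ℝ} {ψ : Space 2 → SO3}
    (h : WindingLift C 0 n ψ) : ∃ φ : gaugeGroup 2, ∀ x, n x = -rot (φ.1 x) kVec := by
  refine ⟨⟨ψ, h.smooth, {x | ∀ i, |x i| ≤ C}, isCompact_box _, fun x hx => ?_⟩, h.lift⟩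
  simp only [Set.mem_ofPred_eq, not_forall, not_le] at hx
  obtain ⟨i, hi⟩ := hx
  fin_cases i
  · exact h.eq_one x hi.le
  · rcases le_abs.1 hi.le with hi | hi
    · rw [h.eq_rotZ x hi]; simp [rotZ_zero]
    · exact h.eq_one_of_le x (le_neg_of_le_neg hi)

/-! ### The connection form and the degree integrand. -/

/-- The structure equation of an orthonormal frame `A` with infinitesimal variations `X`, `Y`. -/
lemma frame_structure_equation (A : SO3) {X Y : Matrix (Fin 3) (Fin 3) ℝ}
    (hX : Xᵀ * (A : Matrix (Fin 3) (Fin 3) ℝ) + (A : Matrix (Fin 3) (Fin 3) ℝ)ᵀ * X = 0)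
    (hY : Yᵀ * (A : Matrix (Fin 3) (Fin 3) ℝ) + (A : Matrix (Fin 3) (Fin 3) ℝ)ᵀ * Y = 0) :
    (fun i => (A : Matrix (Fin 3) (Fin 3) ℝ) i 2) ⬝ᵥ
      crossProduct (fun i => X i 2) (fun i => Y i 2) =
    ∑ k, (X k 0 * Y k 1 - Y k 0 * X k 1) := by
  have hd := coe_det A
  have ho := coe_orthogonal A
  have ho' := coe_orthogonal' A
  generalize (A : Matrix (Fin 3) (Fin 3) ℝ) = B at *
  have skew : ∀ {Z : Matrix (Fin 3) (Fin 3) ℝ}, Zᵀ * B + Bᵀ * Z = 0 →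
      ∃ a b c : ℝ, Z = B * !![0, -a, -b; a, 0, -c; b, c, 0] := by
    intro Z hZ
    have hs : ∀ i j, (Bᵀ * Z) i j = -(Bᵀ * Z) j i := fun i j => by
      have := congrFun (congrFun hZ i) j
      rw [Matrix.add_apply, show Zᵀ * B = (Bᵀ * Z)ᵀ by simp, Matrix.transpose_apply,
        Matrix.zero_apply] at this
      linarith
    refine ⟨(Bᵀ * Z) 1 0, (Bᵀ * Z) 2 0, (Bᵀ * Z) 2 1, ?_⟩
    have : Bᵀ * Z = !![0, -(Bᵀ * Z) 1 0, -(Bᵀ * Z) 2 0; (Bᵀ * Z) 1 0, 0, -(Bᵀ * Z) 2 1;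
        (Bᵀ * Z) 2 0, (Bᵀ * Z) 2 1, 0] := by
      ext i j
      have h1 := hs i j
      fin_cases i <;> fin_cases j <;> first | exact h1 | rfl | exact self_eq_neg.1 h1
    rw [← this, ← Matrix.mul_assoc, ho, Matrix.one_mul]
  obtain ⟨a, b, c, rfl⟩ := skew hX
  obtain ⟨a', b', c', rfl⟩ := skew hY
  have o22 := congrFun (congrFun ho' 2) 2
  have o02 := congrFun (congrFun ho' 0) 2
  have o12 := congrFun (congrFun ho' 1) 2
  simp [Matrix.mul_apply, Fin.sum_univ_three] at o22 o02 o12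
  simp [Matrix.det_fin_three] at hd
  simp [Matrix.mul_apply, Fin.sum_univ_three, cross_apply, dotProduct]
  -- The left side is `(b c' - c b') det B`; the right side is the same factor times the squared
  -- third column, plus multiples of its products with the other columns.
  linear_combination (b * c' - c * b') * hd - (b * c' - c * b') * o22
    - (b' * a - b * a') * o02 - (a * c' - a' * c) * o12

variable {ψ : Space 2 → SO3}

/-- The connection form `e₁ · de₂` of a moving frame, evaluated at a coordinate vector. -/
def connForm (ψ : Space 2 → SO3) (v : Fin 2) (x : Space 2) : ℝ :=
  ∑ k, (ψ x : Matrix (Fin 3) (Fin 3) ℝ) k 0 *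
    fderiv ℝ (fun y => (ψ y : Matrix (Fin 3) (Fin 3) ℝ) k 1) x (EuclideanSpace.single v 1)

lemma contDiff_fderiv_apply {E : Type*} [NormedAddCommGroup E] [NormedSpace ℝ E] {f : E → ℝ}
    (hf : ContDiff ℝ ∞ f) (v : E) : ContDiff ℝ ∞ fun x => fderiv ℝ f x v :=
  (hf.fderiv_right (m := ∞) (by simp)).clm_apply contDiff_const

lemma contDiff_connForm (hψ : SmoothRot ψ) (v : Fin 2) : ContDiff ℝ ∞ (connForm ψ v) :=
  ContDiff.sum fun k _ => (hψ k 0).mul (contDiff_fderiv_apply (hψ k 1) _)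

lemma SmoothRot.differentiableAt (hψ : SmoothRot ψ) (i j : Fin 3) (x : Space 2) :
    DifferentiableAt ℝ (fun y => (ψ y : Matrix (Fin 3) (Fin 3) ℝ) i j) x :=
  (hψ i j).contDiffAt.differentiableAt (by simp)

/-- The entrywise derivative of a moving frame. -/
def frameDeriv (ψ : Space 2 → SO3) (v : Space 2) (x : Space 2) : Matrix (Fin 3) (Fin 3) ℝ :=
  Matrix.of fun i j => fderiv ℝ (fun y => (ψ y : Matrix (Fin 3) (Fin 3) ℝ) i j) x v

/-- This is the derivative of `ψᵀψ = 1`. -/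
lemma frameDeriv_skew (hψ : SmoothRot ψ) (v x : Space 2) :
    (frameDeriv ψ v x)ᵀ * (ψ x : Matrix (Fin 3) (Fin 3) ℝ) +
      (ψ x : Matrix (Fin 3) (Fin 3) ℝ)ᵀ * frameDeriv ψ v x = 0 := by
  ext i j
  have h1 : HasFDerivAt (fun y => ∑ k, (ψ y : Matrix (Fin 3) (Fin 3) ℝ) k i *
      (ψ y : Matrix (Fin 3) (Fin 3) ℝ) k j) _ x :=
    HasFDerivAt.fun_sum fun k _ => (hψ.differentiableAt k i x).hasFDerivAt.mul
      (hψ.differentiableAt k j x).hasFDerivAt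
  have h2 : (fun y => ∑ k, (ψ y : Matrix (Fin 3) (Fin 3) ℝ) k i *
      (ψ y : Matrix (Fin 3) (Fin 3) ℝ) k j) = fun _ => (1 : Matrix (Fin 3) (Fin 3) ℝ) i j := by
    funext y
    rw [← coe_orthogonal' (ψ y)]
    simp [Matrix.mul_apply]
  rw [h2] at h1
  have h3 := congrArg (fun L => L v) (h1.unique (hasFDerivAt_const _ x))
  simp only [Matrix.add_apply, Matrix.mul_apply, Matrix.transpose_apply, Matrix.zero_apply,
    frameDeriv, Matrix.of_apply]
  rw [← Finset.sum_add_distrib]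
  rw [← show _ = (0 : ℝ) from h3]
  simp only [_root_.sum_apply, _root_.add_apply,
    _root_.smul_apply, smul_eq_mul]
  exact Finset.sum_congr rfl fun k _ => by ring

lemma fderiv_connForm (hψ : SmoothRot ψ) (v : Fin 2) (x u : Space 2) :
    fderiv ℝ (connForm ψ v) x u =
      ∑ k, (frameDeriv ψ u x k 0 * frameDeriv ψ (EuclideanSpace.single v 1) x k 1 +
        (ψ x : Matrix (Fin 3) (Fin 3) ℝ) k 0 *
          fderiv ℝ (fderiv ℝ fun y => (ψ y : Matrix (Fin 3) (Fin 3) ℝ) k 1) x u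
            (EuclideanSpace.single v 1)) := by
  have hd : ∀ k, DifferentiableAt ℝ
      (fderiv ℝ fun y => (ψ y : Matrix (Fin 3) (Fin 3) ℝ) k 1) x := fun k =>
    ((hψ k 1).fderiv_right (m := ∞) (by simp)).contDiffAt.differentiableAt (by simp)
  have h1 : HasFDerivAt (connForm ψ v) _ x :=
    HasFDerivAt.fun_sum fun k _ => (hψ.differentiableAt k 0 x).hasFDerivAt.mul
      ((hd k).hasFDerivAt.clm_apply (hasFDerivAt_const (EuclideanSpace.single v (1 : ℝ)) x))
  rw [h1.fderiv]
  simp only [_root_.sum_apply, frameDeriv, Matrix.of_apply]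
  refine Finset.sum_congr rfl fun k _ => ?_
  simp
  ring

/-- The second derivatives cancel by symmetry, leaving the products of first derivatives in
`frame_structure_equation`. -/
lemma connForm_curl (hψ : SmoothRot ψ) (x : Space 2) :
    fderiv ℝ (connForm ψ 1) x (EuclideanSpace.single 0 1) -
      fderiv ℝ (connForm ψ 0) x (EuclideanSpace.single 1 1) =
    (fun i => (ψ x : Matrix (Fin 3) (Fin 3) ℝ) i 2) ⬝ᵥ
      crossProduct (fun i => frameDeriv ψ (EuclideanSpace.single 0 1) x i 2)
        (fun i => frameDeriv ψ (EuclideanSpace.single 1 1) x i 2) := by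
  rw [frame_structure_equation (ψ x) (frameDeriv_skew hψ _ x) (frameDeriv_skew hψ _ x),
    fderiv_connForm hψ, fderiv_connForm hψ, ← Finset.sum_sub_distrib]
  refine Finset.sum_congr rfl fun k _ => ?_
  have hs : IsSymmSndFDerivAt ℝ (fun y => (ψ y : Matrix (Fin 3) (Fin 3) ℝ) k 1) x :=
    (hψ k 1).contDiffAt.isSymmSndFDerivAt (by
      rw [minSmoothness_of_isRCLikeNormedField]
      exact WithTop.coe_le_coe.2 (le_top : (2 : ℕ∞) ≤ ⊤))
  rw [hs (EuclideanSpace.single 0 1) (EuclideanSpace.single 1 1)]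
  ring

/-- The field is minus the third column and the integrand is cubic in it, so the curl appears with
the opposite sign. -/
lemma degree_integrand_eq {n : Space 2 → Fin 3 → ℝ} (hψ : SmoothRot ψ)
    (hn : ∀ x, n x = -rot (ψ x) kVec) (x : Space 2) :
    n x ⬝ᵥ crossProduct (partialDeriv n 0 x) (partialDeriv n 1 x) =
      fderiv ℝ (connForm ψ 0) x (EuclideanSpace.single 1 1) -
        fderiv ℝ (connForm ψ 1) x (EuclideanSpace.single 0 1) := by
  have hn' : n = fun x i => -(ψ x : Matrix (Fin 3) (Fin 3) ℝ) i 2 := by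
    funext x i
    rw [hn, Pi.neg_apply, rot_kVec_apply]
  have hp : ∀ v, partialDeriv n v x =
      -fun i => frameDeriv ψ (EuclideanSpace.single v 1) x i 2 := fun v => by
    have h1 : HasFDerivAt n (ContinuousLinearMap.pi fun i =>
        -fderiv ℝ (fun y => (ψ y : Matrix (Fin 3) (Fin 3) ℝ) i 2) x) x := by
      rw [hn']
      exact hasFDerivAt_pi.2 fun i => (hψ.differentiableAt i 2 x).hasFDerivAt.neg
    rw [partialDeriv, h1.fderiv]
    rfl
  have hx : n x = -fun i => (ψ x : Matrix (Fin 3) (Fin 3) ℝ) i 2 := by rw [hn']; rfl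
  rw [hp, hp, hx]
  have := connForm_curl hψ x
  simp only [map_neg, LinearMap.neg_apply, neg_neg, neg_dotProduct]
  linarith

/-- For `e₁ = (cos τ, sin τ, 0)` and `e₂ = (-sin τ, cos τ, 0)` one has `e₁ · de₂ = -dτ`. -/
lemma connForm_of_eventuallyEq {τ : Space 2 → ℝ} {x : Space 2}
    (h : ∀ᶠ y in nhds x, ψ y = rotZ (τ y)) (hτ : DifferentiableAt ℝ τ x) (v : Fin 2) :
    connForm ψ v x = -fderiv ℝ τ x (EuclideanSpace.single v 1) := by
  have e : ∀ i j, (fun y => (ψ y : Matrix (Fin 3) (Fin 3) ℝ) i j) =ᶠ[nhds x]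
      fun y => (rotZ (τ y) : Matrix (Fin 3) (Fin 3) ℝ) i j := fun i j =>
    h.mono fun y hy => by simp only [hy]
  have h0 : HasFDerivAt (fun y => (ψ y : Matrix (Fin 3) (Fin 3) ℝ) 0 1) _ x :=
    (show HasFDerivAt (fun y => -Real.sin (τ y)) _ x from hτ.hasFDerivAt.sin.neg).congr_of_eventuallyEq
      (e 0 1)
  have h1 : HasFDerivAt (fun y => (ψ y : Matrix (Fin 3) (Fin 3) ℝ) 1 1) _ x :=
    (show HasFDerivAt (fun y => Real.cos (τ y)) _ x from hτ.hasFDerivAt.cos).congr_of_eventuallyEq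
      (e 1 1)
  have h2 : (ψ x : Matrix (Fin 3) (Fin 3) ℝ) 2 0 = 0 := by
    rw [(e 2 0).eq_of_nhds]; simp [coe_rotZ]
  have h3 : (ψ x : Matrix (Fin 3) (Fin 3) ℝ) 0 0 = Real.cos (τ x) := by
    rw [(e 0 0).eq_of_nhds]; simp [coe_rotZ]
  have h4 : (ψ x : Matrix (Fin 3) (Fin 3) ℝ) 1 0 = Real.sin (τ x) := by
    rw [(e 1 0).eq_of_nhds]; simp [coe_rotZ]
  rw [connForm, Fin.sum_univ_three, h0.fderiv, h1.fderiv, h2, h3, h4]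
  have := Real.sin_sq_add_cos_sq (τ x)
  simp
  linear_combination (-fderiv ℝ τ x (EuclideanSpace.single v 1)) * this

lemma connForm_eq_zero {x : Space 2} (h : ∀ᶠ y in nhds x, ψ y = 1) (v : Fin 2) :
    connForm ψ v x = 0 := by
  rw [connForm_of_eventuallyEq (τ := fun _ => 0) (by simpa only [rotZ_zero] using h)
    (differentiableAt_const _)]
  simp

/-! ### Integrals of derivatives. -/

open MeasureTheory

lemma integrable_fderiv_apply {E : Type*} [NormedAddCommGroup E] [NormedSpace ℝ E]
    [MeasurableSpace E] [BorelSpace E] {μ : Measure E} [IsFiniteMeasureOnCompacts μ]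
    {f : E → ℝ} (hf : ContDiff ℝ ∞ f) (hc : HasCompactSupport f) (v : E) :
    Integrable (fun x => fderiv ℝ f x v) μ :=
  (contDiff_fderiv_apply hf v).continuous.integrable_of_hasCompactSupport
    ((hc.fderiv (𝕜 := ℝ)).comp_left (g := fun L : E →L[ℝ] ℝ => L v) rfl)

lemma integral_fderiv_apply_eq_zero {E : Type*} [NormedAddCommGroup E] [NormedSpace ℝ E]
    [FiniteDimensional ℝ E] [MeasurableSpace E] [BorelSpace E] {μ : Measure E}
    [μ.IsAddHaarMeasure] {f : E → ℝ} (hf : ContDiff ℝ ∞ f) (hc : HasCompactSupport f) (v : E) :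
    ∫ x, fderiv ℝ f x v ∂μ = 0 := by
  -- Integration by parts against the constant 1.
  have h := integral_mul_fderiv_eq_neg_fderiv_mul_of_integrable (μ := μ) (f := f)
    (g := fun _ => (1 : ℝ)) (v := v) (by simpa using integrable_fderiv_apply hf hc v) (by simp)
    (by simpa using hf.continuous.integrable_of_hasCompactSupport hc)
    (fun x _ => hf.contDiffAt.differentiableAt (by simp)) fun x _ => differentiableAt_const _
  simpa using h

lemma contDiff_deriv_smoothTransition : ContDiff ℝ ∞ (deriv Real.smoothTransition) :=
  ((contDiff_infty_iff_deriv (𝕜 := ℝ)).1 Real.smoothTransition.contDiff).2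

lemma deriv_smoothTransition_of_neg {t : ℝ} (ht : t < 0) : deriv Real.smoothTransition t = 0 := by
  have : Real.smoothTransition =ᶠ[nhds t] fun _ => 0 :=
    (eventually_lt_nhds ht).mono fun s hs => Real.smoothTransition.zero_of_nonpos hs.le
  rw [this.deriv_eq, deriv_const]

lemma deriv_smoothTransition_of_one_lt {t : ℝ} (ht : 1 < t) :
    deriv Real.smoothTransition t = 0 := by
  have : Real.smoothTransition =ᶠ[nhds t] fun _ => 1 :=
    (eventually_gt_nhds ht).mono fun s hs => Real.smoothTransition.one_of_one_le (le_of_lt hs)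
  rw [this.deriv_eq, deriv_const]

lemma integral_deriv_smoothTransition : ∫ t, deriv Real.smoothTransition t = 1 := by
  have hi : Integrable (deriv Real.smoothTransition) := by
    refine contDiff_deriv_smoothTransition.continuous.integrable_of_hasCompactSupport
      (HasCompactSupport.intro (isCompact_Icc (a := (0 : ℝ)) (b := 1)) fun t ht => ?_)
    rw [Set.mem_Icc, not_and_or, not_le, not_le] at ht
    exact ht.elim deriv_smoothTransition_of_neg deriv_smoothTransition_of_one_lt
  have h := integral_of_hasDerivAt_of_tendsto (f := Real.smoothTransition) (m := 0) (n := 1)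
    (fun t => ((Real.smoothTransition.contDiff (n := 1)).differentiable
      (by simp) t).hasDerivAt) hi
    (tendsto_const_nhds.congr' ((Filter.eventually_le_atBot 0).mono fun t ht =>
      (Real.smoothTransition.zero_of_nonpos ht).symm))
    (tendsto_const_nhds.congr' ((Filter.eventually_ge_atTop 1).mono fun t ht =>
      (Real.smoothTransition.one_of_one_le ht).symm))
  simpa using h

lemma integral_deriv_smoothTransition_mul :
    ∫ x : Space 2, deriv Real.smoothTransition (x 0) * deriv Real.smoothTransition (x 1) = 1 := by
  have h := integral_fintype_prod_volume_eq_prod (𝕜 := ℝ) (ι := Fin 2) (E := fun _ => ℝ)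
    fun _ => deriv Real.smoothTransition
  simp only [integral_deriv_smoothTransition, Fin.prod_univ_two, mul_one] at h
  rw [← h]
  exact (PiLp.volume_preserving_ofLp (Fin 2)).integral_comp
    (MeasurableEquiv.toLp 2 (Fin 2 → ℝ)).symm.measurableEmbedding
    fun y => deriv Real.smoothTransition (y 0) * deriv Real.smoothTransition (y 1)

/-! ### Stokes' theorem for a winding lift. -/

/-- The model of the first component of the connection form of a winding lift. -/
def windingModel (w : ℝ) (x : Space 2) : ℝ :=
  w * deriv Real.smoothTransition (x 0) * Real.smoothTransition (x 1)

lemma contDiff_windingModel (w : ℝ) : ContDiff ℝ ∞ (windingModel w) :=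
  (contDiff_const.mul (contDiff_deriv_smoothTransition.comp (contDiff_coord 0))).mul
    (contDiff_smoothTransition_coord 1)

lemma hasFDerivAt_comp_coord {g : ℝ → ℝ} (hg : ContDiff ℝ ∞ g) (i : Fin 2) (x : Space 2) :
    HasFDerivAt (fun y : Space 2 => g (y i))
      (deriv g (x i) • EuclideanSpace.proj (𝕜 := ℝ) i) x :=
  (hg.differentiable (by simp) (x i)).hasDerivAt.comp_hasFDerivAt x
    (EuclideanSpace.proj (𝕜 := ℝ) i).hasFDerivAt

lemma fderiv_windingModel (w : ℝ) (x : Space 2) :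
    fderiv ℝ (windingModel w) x (EuclideanSpace.single 1 1) =
      w * (deriv Real.smoothTransition (x 0) * deriv Real.smoothTransition (x 1)) := by
  have h : HasFDerivAt (windingModel w) _ x :=
    ((hasFDerivAt_comp_coord contDiff_deriv_smoothTransition 0 x).const_mul w).mul
      (hasFDerivAt_comp_coord Real.smoothTransition.contDiff 1 x)
  rw [h.fderiv]
  simp
  ring

lemma hasCompactSupport_of_box {C : ℝ} {f : Space 2 → ℝ} (h0 : ∀ x, C < |x 0| → f x = 0)
    (h1 : ∀ x, x 1 < -C → f x = 0) (h2 : ∀ x, C < x 1 → f x = 0) : HasCompactSupport f := by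
  refine HasCompactSupport.intro (isCompact_box C) fun x hx => ?_
  simp only [Set.mem_ofPred_eq, not_forall, not_le] at hx
  obtain ⟨i, hi⟩ := hx
  fin_cases i
  · exact h0 x hi
  · rcases lt_abs.1 hi with hi | hi
    · exact h2 x hi
    · exact h1 x (lt_neg_of_lt_neg hi)

variable {C w : ℝ} {n : Space 2 → Fin 3 → ℝ} {ψ : Space 2 → SO3}

lemma WindingLift.connForm_of_lt_abs (h : WindingLift C w n ψ) {x : Space 2} (hx : C < |x 0|)
    (v : Fin 2) : connForm ψ v x = 0 :=
  connForm_eq_zero (((contDiff_coord (0 : Fin 2)).continuous.abs.continuousAt.eventually_const_lt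
    hx).mono fun y hy => h.eq_one y (le_of_lt hy)) v

lemma WindingLift.connForm_of_lt_neg (h : WindingLift C w n ψ) {x : Space 2} (hx : x 1 < -C)
    (v : Fin 2) : connForm ψ v x = 0 :=
  connForm_eq_zero (((contDiff_coord (1 : Fin 2)).continuous.continuousAt.eventually_lt_const
    hx).mono fun y hy => h.eq_one_of_le y (le_of_lt hy)) v

lemma WindingLift.connForm_of_lt (h : WindingLift C w n ψ) {x : Space 2} (hx : C < x 1)
    (v : Fin 2) : connForm ψ v x =
      w * deriv Real.smoothTransition (x 0) * (EuclideanSpace.single v (1 : ℝ) : Space 2) 0 := by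
  have hd : HasFDerivAt (fun y : Space 2 => -(Real.smoothTransition (y 0) * w)) _ x :=
    ((hasFDerivAt_comp_coord Real.smoothTransition.contDiff 0 x).mul_const w).neg
  rw [connForm_of_eventuallyEq (τ := fun y => -(Real.smoothTransition (y 0) * w))
    (((contDiff_coord (1 : Fin 2)).continuous.continuousAt.eventually_const_lt
      hx).mono fun y hy => h.eq_rotZ y (le_of_lt hy)) hd.differentiableAt, hd.fderiv]
  simp

lemma WindingLift.hasCompactSupport_connForm_one (h : WindingLift C w n ψ) :
    HasCompactSupport (connForm ψ 1) :=
  hasCompactSupport_of_box (C := C) (fun _ hx => h.connForm_of_lt_abs hx 1)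
    (fun _ hx => h.connForm_of_lt_neg hx 1) fun _ hx => by rw [h.connForm_of_lt hx]; simp

/-- The component along `x 0` persists for all large `x 1` when `w ≠ 0`. The model agrees with it
outside the box; `1 ≤ C` ensures that both transitions are complete there. -/
lemma WindingLift.hasCompactSupport_connForm_zero_sub (hC : 1 ≤ C) (h : WindingLift C w n ψ) :
    HasCompactSupport fun x => connForm ψ 0 x - windingModel w x := by
  refine hasCompactSupport_of_box (C := C) (fun x hx => ?_) (fun x hx => ?_) fun x hx => ?_
  · rw [h.connForm_of_lt_abs hx, windingModel]
    rcases lt_abs.1 hx with hx | hx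
    · rw [deriv_smoothTransition_of_one_lt (by linarith)]; ring
    · rw [deriv_smoothTransition_of_neg (by linarith)]; ring
  · rw [h.connForm_of_lt_neg hx, windingModel,
      Real.smoothTransition.zero_of_nonpos (by linarith)]
    ring
  · rw [h.connForm_of_lt hx, windingModel, Real.smoothTransition.one_of_one_le (by linarith)]
    simp

/-- Derivatives of the compactly supported parts integrate to zero; the model contributes `w` times
the product of two integrals equal to 1. -/
lemma WindingLift.degree_eq (hC : 1 ≤ C) (h : WindingLift C w n ψ) :
    degree n = 1 / (4 * Real.pi) * w := by
  have s0 := contDiff_connForm h.smooth 0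
  have s1 := contDiff_connForm h.smooth 1
  have sm := contDiff_windingModel w
  have ht : ∀ x, n x ⬝ᵥ crossProduct (partialDeriv n 0 x) (partialDeriv n 1 x) =
      (fderiv ℝ (fun x => connForm ψ 0 x - windingModel w x) x (EuclideanSpace.single 1 1) -
        fderiv ℝ (connForm ψ 1) x (EuclideanSpace.single 0 1)) +
      w * (deriv Real.smoothTransition (x 0) * deriv Real.smoothTransition (x 1)) := fun x => by
    rw [degree_integrand_eq h.smooth h.lift, ← fderiv_windingModel,
      fderiv_fun_sub (s0.differentiable (by simp) x) (sm.differentiable (by simp) x)]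
    simp
    ring
  have i0 := integrable_fderiv_apply (μ := (volume : Measure (Space 2))) (s0.sub sm)
    (h.hasCompactSupport_connForm_zero_sub hC) (EuclideanSpace.single 1 1)
  have i1 := integrable_fderiv_apply (μ := (volume : Measure (Space 2))) s1
    h.hasCompactSupport_connForm_one (EuclideanSpace.single 0 1)
  have i01 : Integrable fun x : Space 2 =>
      fderiv ℝ (fun x => connForm ψ 0 x - windingModel w x) x (EuclideanSpace.single 1 1) -
        fderiv ℝ (connForm ψ 1) x (EuclideanSpace.single 0 1) := i0.sub i1
  have i2 : Integrable fun x : Space 2 =>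
      w * (deriv Real.smoothTransition (x 0) * deriv Real.smoothTransition (x 1)) := by
    -- A function that is not integrable has integral 0 by convention, so the value 1 already proves
    -- integrability.
    refine (Integrable.of_integral_ne_zero ?_).const_mul w
    rw [integral_deriv_smoothTransition_mul]
    exact one_ne_zero
  rw [degree, integral_congr_ae (Filter.Eventually.of_forall ht), integral_add i01 i2,
    integral_sub i0 i1, integral_fderiv_apply_eq_zero (s0.sub sm)
      (h.hasCompactSupport_connForm_zero_sub hC),
    integral_fderiv_apply_eq_zero s1 h.hasCompactSupport_connForm_one, integral_const_mul,
    integral_deriv_smoothTransition_mul]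
  ring

lemma windingLift_of_gauge {φ : gaugeGroup 2} (hn : ∀ x, n x = -rot (φ.1 x) kVec) :
    ∃ C, 1 ≤ C ∧ WindingLift C 0 n φ.1 := by
  obtain ⟨R, -, hB⟩ := exists_boxSupported φ.2.2
  refine ⟨max R 1, le_max_right _ _, φ.2.1, hn,
    fun x hx => hB.eq_const x 0 (Finset.mem_univ _) ((le_max_left _ _).trans hx),
    fun x hx => hB.eq_const x 1 (Finset.mem_univ _)
      ((le_max_left R 1).trans (le_abs.2 (Or.inr (le_neg_of_le_neg hx)))), fun x hx => ?_⟩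
  rw [hB.eq_const x 1 (Finset.mem_univ _) ((le_max_left R 1).trans (le_abs.2 (Or.inl hx)))]
  simp [rotZ_zero]

/-- A field on the plane has a lift if and only if its degree vanishes. -/
lemma exists_gauge_lift_two_iff (n : unitFields 2) :
    (∃ ψ : gaugeGroup 2, ∀ x, n.1 x = -rot (ψ.1 x) kVec) ↔ degree n.1 = 0 := by
  constructor
  · rintro ⟨φ, hφ⟩
    obtain ⟨C, hC, h⟩ := windingLift_of_gauge hφ
    rw [h.degree_eq hC, mul_zero]
  · intro hdeg
    obtain ⟨C, w, hC, ψ, h⟩ := exists_windingLift n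
    rw [h.degree_eq hC] at hdeg
    have hw : w = 0 := by
      rcases mul_eq_zero.1 hdeg with h0 | h0
      · exact absurd h0 (by positivity)
      · exact h0
    subst hw
    exact h.exists_gauge

lemma exists_gauge_lift {p : ℕ} (hp : 1 ≤ p) (hp2 : p ≠ 2) (n : unitFields p) :
    ∃ ψ : gaugeGroup p, ∀ x, n.1 x = -rot (ψ.1 x) kVec := by
  match p, hp, hp2 with
  | 1, _, _ => exact exists_gauge_lift_one n
  | q + 3, _, _ => exact exists_gauge_lift_add_three n

/-! ### The reduced space. -/

lemma covector_eq {p : ℕ} {z : CotangentBundle p} (hz : z ∈ levelSet (constK p)) (x : Space p) :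
    z.covector.1 x = -rot (z.base.1 x) kVec := by
  have h : -rot (z.base.1 x)⁻¹ (z.covector.1 x) = kVec := congrFun (congrArg Subtype.val hz) x
  rw [← h, rot_neg, neg_neg, ← rot_mul, mul_inv_cancel, rot_one]

lemma reducedToField_injective (p : ℕ) : Function.Injective (reducedToField p) := by
  intro a b
  refine Quotient.inductionOn₂ a b fun z w hzw => Quotient.sound ?_
  have hx : ∀ x, rot (z.1.base.1 x) kVec = rot (w.1.base.1 x) kVec := fun x =>
    neg_injective (congrFun (congrArg Subtype.val hzw) x)
  -- The only group element that can carry `w` to `z`; equality of the fields says that it fixes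
  -- `𝐤`.
  refine ⟨⟨z.1.base⁻¹ * w.1.base, ?_⟩, ?_⟩
  · apply Subtype.ext
    funext x
    change rot ((z.1.base.1 x)⁻¹ * w.1.base.1 x) kVec = kVec
    rw [rot_mul, ← hx, ← rot_mul, inv_mul_cancel, rot_one]
  · apply Subtype.ext
    refine CotangentBundle.ext ?_ ?_
    · change w.1.base * (z.1.base⁻¹ * w.1.base)⁻¹ = z.1.base
      simp
    · apply Subtype.ext
      funext x
      change w.1.covector.1 x = z.1.covector.1 x
      rw [covector_eq w.2, covector_eq z.2, hx]

lemma mem_range_reducedToField_iff {p : ℕ} (n : unitFields p) :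
    n ∈ Set.range (reducedToField p) ↔
      ∃ ψ : gaugeGroup p, ∀ x, n.1 x = -rot (ψ.1 x) kVec := by
  constructor
  · rintro ⟨a, rfl⟩
    exact Quotient.inductionOn a fun z => ⟨z.1.base, fun x => rfl⟩
  · rintro ⟨ψ, hψ⟩
    -- The covector is the one forced by `covector_eq`.
    let z : CotangentBundle p := ⟨ψ, -(ψ • constK p)⟩
    have hz : momentumMap z = constK p := by
      apply Subtype.ext
      funext x
      change -rot (ψ.1 x)⁻¹ (-rot (ψ.1 x) kVec) = kVec
      rw [rot_neg, neg_neg, ← rot_mul, inv_mul_cancel, rot_one]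
    exact ⟨Quotient.mk _ ⟨z, hz⟩, Subtype.ext (funext fun x => (hψ x).symm)⟩

end LandauLifshitz

end

open LandauLifshitz in
theorem mainTheorem2 :
    (∀ p : ℕ, 1 ≤ p → p ≠ 2 →
      (∀ n : unitFields p, ∃ ψ : gaugeGroup p, ∀ x, n.1 x = -rot (ψ.1 x) kVec) ∧
      Function.Bijective (reducedToField p)) ∧
    (∀ n : unitFields 2,
      (∃ ψ : gaugeGroup 2, ∀ x, n.1 x = -rot (ψ.1 x) kVec) ↔ degree n.1 = 0) ∧
    Function.Injective (reducedToField 2) ∧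
    Set.range (reducedToField 2) = {n : unitFields 2 | degree n.1 = 0} := by
  refine ⟨fun p hp hp2 => ⟨exists_gauge_lift hp hp2, reducedToField_injective p, fun n =>
    (mem_range_reducedToField_iff n).2 (exists_gauge_lift hp hp2 n)⟩,
    exists_gauge_lift_two_iff, reducedToField_injective 2, ?_⟩
  ext n
  exact (mem_range_reducedToField_iff n).trans (exists_gauge_lift_two_iff n)
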